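/- All graphs are finite and simple. For a graph $G=(V,E)$, let $\mathrm{SSP}(G)\subseteq\mathbb{R}^{V}$ be its stable set polytope, that is, the convex hull of the incidence vectors of the stable sets (sets of pairwise non-adjacent vertices) of $G$. Let $\mathrm{TSTAB}(G)$ be the set of all $x\in\mathbb{R}^{V}$ such that (a) $0\le x_v\le 1$ for every vertex $v$ of $G$; (b) $x_u+x_v\le 1$ for every edge $uv$ of $G$; (c) $\sum_{v\in V(C)}x_v\le \frac{|V(C)|-1}{2}$ for every odd cycle $C$ of $G$. (The upper bound in (a) matters only for isolated vertices.) The graph $G$ is called t-perfect if $\mathrm{SSP}(G)=\mathrm{TSTAB}(G)$. **Theorem.** Every t-perfect graph is $199053$-colourable, that is, its vertex set is a union of $199053$ stable sets. -/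

import Mathlib

namespace SimpleGraph

/-- The stable set polytope of `G`: the convex hull in `ℝ^V` of the incidence vectors of the
stable (independent) sets of `G`. -/
def stableSetPolytope {V : Type*} (G : SimpleGraph V) : Set (V → ℝ) :=
  convexHull ℝ {x | ∃ S : Set V, G.IsIndepSet S ∧ x = S.indicator 1}

open scoped Classical in
/-- The polytope cut out by the vertex bounds, the edge inequalities and the odd cycle
inequalities. The bound `x v ≤ 1` follows from an edge inequality and nonnegativity unless `v` is
isolated; it is listed so that the polyhedron is bounded, and hence the notion of t-perfection is
the usual one, closed under induced subgraphs, also for graphs with isolated vertices. -/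
def tStab {V : Type*} (G : SimpleGraph V) : Set (V → ℝ) :=
  {x | (∀ v, 0 ≤ x v ∧ x v ≤ 1) ∧
    (∀ u v, G.Adj u v → x u + x v ≤ 1) ∧
    (∀ (u : V) (c : G.Walk u u), c.IsCycle → Odd c.length →
      ∑ v ∈ c.support.toFinset, x v ≤ ((c.length : ℝ) - 1) / 2)}

/-- A graph is t-perfect if its stable set polytope is given by the vertex bounds, edge
inequalities and odd cycle inequalities. -/
def IsTPerfect {V : Type*} (G : SimpleGraph V) : Prop :=
  G.stableSetPolytope = G.tStab

end SimpleGraph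

namespace SimpleGraph

/-! ### Convex combinations of stable sets -/

variable {V : Type*} {G : SimpleGraph V}

/-! The hypothesis is used as complementary slackness: a point of `tStab` is a convex combination of
stable sets, and every stable set of positive weight attains each valid inequality that is tight at
the point (`eq_of_weighted_sum_eq`). This is applied to two kinds of points.

If all odd cycles have length at least 2k+1, the constant vector k/(2k+1) is in `tStab` and tight on
the cycles of length 2k+1. A stable set from its decomposition meets all of these, so deleting it
raises the odd girth at the price of one colour. A hundred deletions give odd girth at least 203,
and then balls of radius 100 are bipartite.

The second point gives an obstruction, `false_of_hub`. Let O be an induced odd cycle of length N,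
and A ∪ B a connected bipartite hub, disjoint from O and adjacent to it only through B, where B has
neighbours at three vertices that cut O into odd arcs. The vector with values 1 - 1/N on A, 1/N on B
and (N-1)/(2N) on O is tight on the edges of the hub and on O. A stable set of its decomposition
that meets B contains all of B, hence misses the three vertices, and so has at most (N-3)/2 vertices
on O instead of (N-1)/2.

It remains to find this configuration in a graph of odd girth at least 203 that is not
92808-colourable. In a component K of a distance level from a vertex z that needs many colours,
`exists_closed_rope` builds a rope through five far apart joints. Each of its segments between
consecutive joints has an even and an odd version, so any three joints can be made to cut an induced
odd cycle into odd arcs; `RopeState.step` adds one segment. Below the level, shortest paths from the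
joints to z contain a connected bipartite subgraph reaching all of them (`exists_bipartite_connOn`):
a minimal connected set through five vertices has no cycle longer than five. By pigeonhole three of
the joints attach to the same side of it, which gives the hub (`false_of_odd_cycles_in_level`). -/

theorem exists_stable_combination {x : V → ℝ} (hx : x ∈ G.stableSetPolytope) :
    ∃ (ι : Type) (_ : Fintype ι) (w : ι → ℝ) (S : ι → Set V), (∀ i, 0 < w i) ∧ ∑ i, w i = 1 ∧
      (∀ i, G.IsIndepSet (S i)) ∧ ∀ v, x v = ∑ i, w i * (S i).indicator 1 v := by
  classical
  rw [stableSetPolytope, _root_.convexHull_eq] at hx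
  obtain ⟨ι, t, w, z, hw0, hw1, hz, rfl⟩ := hx
  choose! S hS using hz
  -- Terms of weight zero are dropped, since slackness arguments need strictly positive weights.
  let u := t.filter fun i => w i ≠ 0
  have hu : ∀ f : ι → ℝ, ∑ i ∈ t, w i * f i = ∑ i ∈ u, w i * f i := by
    intro f
    refine (Finset.sum_filter_of_ne ?_).symm
    intro i _ h h0; simp [h0] at h
  let e := u.equivFin
  refine ⟨Fin u.card, inferInstance, fun k => w (e.symm k), fun k => S (e.symm k), ?_, ?_, ?_, ?_⟩
  · intro k
    have := (e.symm k).2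
    simp only [u, Finset.mem_filter] at this
    exact lt_of_le_of_ne (hw0 _ this.1) (Ne.symm this.2)
  · rw [Equiv.sum_comp e.symm (fun i : u => w i), Finset.sum_coe_sort u w]
    have := hu (fun _ => 1); simp only [mul_one] at this
    rw [← this, hw1]
  · intro k
    have := (e.symm k).2
    simp only [u, Finset.mem_filter] at this
    exact (hS _ this.1).1
  · intro v
    rw [Equiv.sum_comp e.symm (fun i : u => w i * (S i).indicator 1 v),
      Finset.sum_coe_sort u (fun i => w i * (S i).indicator 1 v), ← hu]
    rw [Finset.centerMass_eq_of_sum_1 _ _ hw1, Finset.sum_apply]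
    refine Finset.sum_congr rfl fun i hi => ?_
    simp [(hS i hi).2]

theorem combination_mem_stableSetPolytope {ι : Type*} [Fintype ι] {w : ι → ℝ} {S : ι → Set V}
    (hw : ∀ i, 0 ≤ w i) (hw1 : ∑ i, w i = 1) (hS : ∀ i, G.IsIndepSet (S i)) :
    (fun v => ∑ i, w i * (S i).indicator 1 v) ∈ G.stableSetPolytope := by
  have := (convex_convexHull ℝ {x : V → ℝ | ∃ S : Set V, G.IsIndepSet S ∧ x = S.indicator 1}).sum_mem
    (t := Finset.univ) (w := w) (z := fun i => (S i).indicator 1) (fun i _ => hw i) hw1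
    (fun i _ => subset_convexHull ℝ _ ⟨S i, hS i, rfl⟩)
  rw [stableSetPolytope]
  convert this using 1
  ext v
  simp [Finset.sum_apply]

/-- In a convex combination with positive weights, a bound attained on average is attained by
every term. -/
theorem eq_of_weighted_sum_eq {ι : Type*} [Fintype ι] {w g : ι → ℝ} {b : ℝ} (hw : ∀ i, 0 < w i)
    (hw1 : ∑ i, w i = 1) (hg : ∀ i, g i ≤ b) (h : ∑ i, w i * g i = b) (i : ι) : g i = b := by
  have h0 : ∑ i, w i * (b - g i) = 0 := by
    simp only [mul_sub, Finset.sum_sub_distrib, h, ← Finset.sum_mul, hw1]; ring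
  rw [Finset.sum_eq_zero_iff_of_nonneg
    (fun i _ => mul_nonneg (hw i).le (sub_nonneg.2 (hg i)))] at h0
  have := h0 i (Finset.mem_univ i)
  rcases mul_eq_zero.1 this with h1 | h1
  · exact absurd h1 (hw i).ne'
  · linarith

/-! ### Sums around odd cycles -/

theorem sum_Ico_even_le {y : ℕ → ℝ} {a : ℕ} (t : ℕ)
    (h : ∀ i, a ≤ i → i + 1 < a + 2 * t → y i + y (i + 1) ≤ 1) :
    ∑ i ∈ Finset.Ico a (a + 2 * t), y i ≤ t := by
  induction t with
  | zero => simp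
  | succ t ih =>
    have e : a + 2 * (t + 1) = a + 2 * t + 1 + 1 := by ring
    rw [e, Finset.sum_Ico_succ_top (by omega), Finset.sum_Ico_succ_top (by omega)]
    have := ih fun i h1 h2 => h i h1 (by omega)
    have := h (a + 2 * t) (by omega) (by omega)
    push_cast
    linarith

theorem sum_Ico_le_half {y : ℕ → ℝ} {a b : ℕ} (hab : a ≤ b) (he : Even (b - a))
    (h : ∀ i, a ≤ i → i + 1 < b → y i + y (i + 1) ≤ 1) :
    ∑ i ∈ Finset.Ico a b, y i ≤ ((b : ℝ) - a) / 2 := by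
  obtain ⟨t, ht⟩ := he
  have hb : b = a + 2 * t := by omega
  subst hb
  have := sum_Ico_even_le t h
  push_cast
  linarith

/-- Without the zero entry an even number of cyclically consecutive entries is left, and these split
into adjacent pairs. If `j` is odd, one of the pairs wraps around. -/
theorem sum_range_odd_le_of_zero {y : ℕ → ℝ} {N j : ℕ} (hN : Odd N) (hj : j < N)
    (h : ∀ i, i + 1 < N → y i + y (i + 1) ≤ 1) (hw : y (N - 1) + y 0 ≤ 1) (h0 : y j ≤ 0) :
    ∑ i ∈ Finset.range N, y i ≤ ((N : ℝ) - 1) / 2 := by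
  rw [Finset.range_eq_Ico, ← Finset.sum_Ico_consecutive _ (Nat.zero_le j) hj.le,
    Finset.sum_eq_sum_Ico_succ_bot hj]
  rcases Nat.even_or_odd j with he | ho
  · have h1 := sum_Ico_le_half (y := y) (Nat.zero_le j) (by simpa using he)
      (fun i _ hi => h i (by omega))
    have h2 := sum_Ico_le_half (y := y) (a := j + 1) (b := N) (by omega)
      (by grind) (fun i _ hi => h i (by omega))
    push_cast at *
    linarith
  · have hjN : j + 1 < N := by
      rcases Nat.lt_or_ge (j + 1) N with h | h
      · exact h
      · exfalso; have : N = j + 1 := by omega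
        subst this; grind
    obtain ⟨M, rfl⟩ : ∃ M, N = M + 1 := ⟨N - 1, by omega⟩
    rw [Finset.sum_eq_sum_Ico_succ_bot (by grind), Finset.sum_Ico_succ_top (by omega)]
    have h1 := sum_Ico_le_half (y := y) (a := 0 + 1) (b := j) (by grind) (by grind)
      (fun i _ hi => h i (by omega))
    have h2 := sum_Ico_le_half (y := y) (a := j + 1) (b := M) (by omega)
      (by grind) (fun i _ hi => h i (by omega))
    push_cast at *
    linarith

/-- Each of the three arcs has an even number of inner entries, the third because `N` is odd, so all
remaining entries split into adjacent pairs. -/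
theorem sum_range_odd_le_of_three_zeros {y : ℕ → ℝ} {N p q r : ℕ} (hN : Odd N) (hpq : p < q)
    (hqr : q < r) (hr : r < N) (h1 : Odd (q - p)) (h2 : Odd (r - q))
    (h : ∀ i, i + 1 < N → y i + y (i + 1) ≤ 1) (hw : y (N - 1) + y 0 ≤ 1)
    (hp0 : y p ≤ 0) (hq0 : y q ≤ 0) (hr0 : y r ≤ 0) :
    ∑ i ∈ Finset.range N, y i ≤ ((N : ℝ) - 3) / 2 := by
  rw [Finset.range_eq_Ico, ← Finset.sum_Ico_consecutive _ (Nat.zero_le p) (by omega : p ≤ N),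
    ← Finset.sum_Ico_consecutive _ hpq.le (by omega : q ≤ N),
    ← Finset.sum_Ico_consecutive _ hqr.le (by omega : r ≤ N),
    Finset.sum_eq_sum_Ico_succ_bot hpq, Finset.sum_eq_sum_Ico_succ_bot hqr,
    Finset.sum_eq_sum_Ico_succ_bot hr]
  have a1 := sum_Ico_le_half (y := y) (a := p + 1) (b := q) (by omega) (by grind)
      (fun i _ hi => h i (by omega))
  have a2 := sum_Ico_le_half (y := y) (a := q + 1) (b := r) (by omega) (by grind)
      (fun i _ hi => h i (by omega))
  rcases Nat.even_or_odd p with he | ho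
  · have a0 := sum_Ico_le_half (y := y) (Nat.zero_le p) (by simpa using he)
      (fun i _ hi => h i (by omega))
    have a3 := sum_Ico_le_half (y := y) (a := r + 1) (b := N) (by omega)
      (by grind) (fun i _ hi => h i (by omega))
    push_cast at *
    linarith
  · have hrN : r + 1 < N := by
      rcases Nat.lt_or_ge (r + 1) N with h | h
      · exact h
      · exfalso; have : N = r + 1 := by omega
        subst this; grind
    obtain ⟨M, rfl⟩ : ∃ M, N = M + 1 := ⟨N - 1, by omega⟩
    rw [Finset.sum_eq_sum_Ico_succ_bot (by grind : 0 < p), Finset.sum_Ico_succ_top (by omega : r + 1 ≤ M)]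
    have a0 := sum_Ico_le_half (y := y) (a := 0 + 1) (b := p) (by grind) (by grind)
      (fun i _ hi => h i (by omega))
    have a3 := sum_Ico_le_half (y := y) (a := r + 1) (b := M) (by omega)
      (by grind) (fun i _ hi => h i (by omega))
    push_cast at *
    linarith

theorem Walk.IsCycle.sum_support {u : V} {c : G.Walk u u} [DecidableEq V] (hc : c.IsCycle)
    (x : V → ℝ) :
    ∑ v ∈ c.support.toFinset, x v = ∑ i ∈ Finset.range c.length, x (c.getVert i) := by
  have h3 := hc.three_le_length
  have : c.support.toFinset = (Finset.range c.length).image c.getVert := by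
    ext v
    simp only [List.mem_toFinset, Finset.mem_image, Finset.mem_range, Walk.mem_support_iff_exists_getVert]
    constructor
    · rintro ⟨n, rfl, hn⟩
      rcases hn.lt_or_eq with h | h
      · exact ⟨n, h, rfl⟩
      · exact ⟨0, by omega, by simp [h]⟩
    · rintro ⟨n, hn, rfl⟩
      exact ⟨n, rfl, hn.le⟩
  rw [this, Finset.sum_image]
  intro i hi j hj hij
  simp only [Finset.coe_range, Set.mem_Iio] at hi hj
  exact hc.getVert_injOn' (by simp; omega) (by simp; omega) hij

/-- It suffices to check the odd cycle inequalities on cycles inside the support. -/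
theorem mem_tStab_of_support {x : V → ℝ} (h01 : ∀ v, 0 ≤ x v ∧ x v ≤ 1)
    (hadj : ∀ u v, G.Adj u v → x u + x v ≤ 1)
    (hc : ∀ (u : V) (c : G.Walk u u), c.IsCycle → Odd c.length →
      (∀ v ∈ c.support, x v ≠ 0) →
      ∑ i ∈ Finset.range c.length, x (c.getVert i) ≤ ((c.length : ℝ) - 1) / 2) :
    x ∈ G.tStab := by
  classical
  refine ⟨h01, hadj, fun u c hcyc hodd => ?_⟩
  have h3 := hcyc.three_le_length
  have key := hcyc.sum_support x
  have goal : ∑ i ∈ Finset.range c.length, x (c.getVert i) ≤ ((c.length : ℝ) - 1) / 2 := by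
    by_cases hs : ∀ v ∈ c.support, x v ≠ 0
    · exact hc u c hcyc hodd hs
    · push Not at hs
      obtain ⟨v, hv, hv0⟩ := hs
      obtain ⟨n, hn, hnl⟩ := Walk.mem_support_iff_exists_getVert.1 hv
      have hz : ∃ j < c.length, x (c.getVert j) ≤ 0 := by
        rcases hnl.lt_or_eq with h | h
        · exact ⟨n, h, by rw [hn, hv0]⟩
        · refine ⟨0, by omega, ?_⟩
          have : c.getVert 0 = v := by rw [← hn, h]; simp
          rw [this, hv0]
      obtain ⟨j, hj, hj0⟩ := hz
      refine sum_range_odd_le_of_zero (y := fun i => x (c.getVert i)) hodd hj ?_ ?_ hj0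
      · intro i hi
        exact hadj _ _ (c.adj_getVert_succ (by omega))
      · have := c.adj_getVert_succ (i := c.length - 1) (by omega)
        have e : c.length - 1 + 1 = c.length := by omega
        rw [e, c.getVert_length] at this
        simpa using hadj _ _ this
  rw [← key] at goal
  convert goal

theorem indicator_add_le {S : Set V} (hS : G.IsIndepSet S) {u v : V} (h : G.Adj u v) :
    S.indicator (1 : V → ℝ) u + S.indicator (1 : V → ℝ) v ≤ 1 := by
  classical
  simp only [Set.indicator_apply, Pi.one_apply]
  by_cases hu : u ∈ S <;> by_cases hv : v ∈ S <;> simp [hu, hv]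
  exact absurd h (hS hu hv h.ne)

/-- A stable set contains at most `m` vertices of a closed walk of length `2 m + 1`. -/
theorem sum_indicator_le {S : Set V} (hS : G.IsIndepSet S) {N : ℕ} {o : ℕ → V} (hN : Odd N)
    (ho : ∀ i, i + 1 < N → G.Adj (o i) (o (i + 1))) (hw : G.Adj (o (N - 1)) (o 0)) :
    ∑ i ∈ Finset.range N, S.indicator (1 : V → ℝ) (o i) ≤ ((N : ℝ) - 1) / 2 := by
  classical
  have hex : ∃ j < N, S.indicator (1 : V → ℝ) (o j) ≤ 0 := by
    by_contra hcon
    push Not at hcon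
    have h1 := hcon 0 (by grind)
    have h2 := hcon (N - 1) (by grind)
    have : ∀ v, 0 < S.indicator (1 : V → ℝ) v → v ∈ S := by
      intro v hv; by_contra h; simp [h] at hv
    exact hS (this _ h2) (this _ h1) hw.ne hw
  obtain ⟨j, hj, hj0⟩ := hex
  exact sum_range_odd_le_of_zero hN hj (fun i hi => indicator_add_le hS (ho i hi))
    (indicator_add_le hS hw) hj0

/-! ### Induced subgraphs and raising the odd girth -/

/-- A point is extended by zero; `mem_tStab_of_support` disposes of the cycles that leave `X`. The
stable sets of the decomposition are then restricted to `X`. -/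
theorem tStab_subset_induce (hG : G.tStab ⊆ G.stableSetPolytope) (X : Set V) :
    (G.induce X).tStab ⊆ (G.induce X).stableSetPolytope := by
  classical
  rintro x ⟨h01, hadj, hcyc⟩
  let y : V → ℝ := fun v => if h : v ∈ X then x ⟨v, h⟩ else 0
  have hy : ∀ v (h : v ∈ X), y v = x ⟨v, h⟩ := fun v h => by simp [y, h]
  have hy0 : ∀ v, v ∉ X → y v = 0 := fun v h => by simp [y, h]
  have hmem : y ∈ G.tStab := by
    have hb : ∀ v, 0 ≤ y v ∧ y v ≤ 1 := by
      intro v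
      by_cases h : v ∈ X
      · rw [hy v h]; exact h01 _
      · rw [hy0 v h]; norm_num
    refine mem_tStab_of_support hb ?_ ?_
    · intro u v huv
      by_cases hu : u ∈ X
      · by_cases hv : v ∈ X
        · rw [hy u hu, hy v hv]; exact hadj _ _ huv
        · rw [hy0 v hv]; linarith [(hb u).2]
      · rw [hy0 u hu]; linarith [(hb v).2]
    · intro u c hc hodd hs
      have hX : ∀ v ∈ c.support, v ∈ X := fun v hv => by
        by_contra h; exact hs v hv (hy0 v h)
      have hmap := c.map_induce hX
      have hc' : (c.induce X hX).IsCycle := by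
        rw [← Walk.isCycle_map_iff_of_injective (f := (Embedding.induce X).toHom)
          (Embedding.induce (G := G) X).injective]
        rw [hmap]; exact hc
      have hlen : (c.induce X hX).length = c.length :=
        (Walk.length_map _ (c.induce X hX)).symm.trans (congrArg Walk.length hmap)
      have := hcyc _ _ hc' (by rw [hlen]; exact hodd)
      have e := hc'.sum_support x
      have e2 : ∑ i ∈ Finset.range c.length, y (c.getVert i) =
          ∑ i ∈ Finset.range (c.induce X hX).length, x ((c.induce X hX).getVert i) := by
        rw [hlen]
        refine Finset.sum_congr rfl fun i _ => ?_
        have : c.getVert i = ((c.induce X hX).getVert i : V) :=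
          (congrArg (fun d => Walk.getVert d i) hmap).symm.trans
            (Walk.getVert_map _ (c.induce X hX) i)
        rw [this, hy _ ((c.induce X hX).getVert i).2]
      rw [e2, ← hlen, ← e]
      convert this
  obtain ⟨ι, _, w, S, hw, hw1, hS, hx⟩ := exists_stable_combination (hG hmem)
  have := combination_mem_stableSetPolytope (G := G.induce X) (w := w)
    (S := fun i => ((↑) : X → V) ⁻¹' S i) (fun i => (hw i).le) hw1 (fun i => by
      intro a ha b hb hab h
      exact hS i ha hb (fun h' => hab (Subtype.ext h')) h)
  convert this using 1
  ext v
  rw [← hy v v.2, hx]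
  rfl

/-- All odd cycles of `G` have length at least `n`. -/
def OddGirthGE (G : SimpleGraph V) (n : ℕ) : Prop :=
  ∀ (u : V) (c : G.Walk u u), c.IsCycle → Odd c.length → n ≤ c.length

theorem OddGirthGE.induce {n : ℕ} (h : G.OddGirthGE n) (X : Set V) :
    (G.induce X).OddGirthGE n := by
  intro u c hc ho
  have := h _ (c.map (Embedding.induce X).toHom)
    (hc.map (Embedding.induce (G := G) X).injective) (by rw [Walk.length_map]; exact ho)
  rwa [Walk.length_map] at this

/-- Deleting a suitable stable set raises the odd girth. -/
theorem exists_stable_raising_oddGirth (hG : G.tStab ⊆ G.stableSetPolytope) {k : ℕ} (hk : 1 ≤ k)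
    (hodd : G.OddGirthGE (2 * k + 1)) :
    ∃ S : Set V, G.IsIndepSet S ∧ (G.induce Sᶜ).OddGirthGE (2 * k + 3) := by
  classical
  have hk' : (1 : ℝ) ≤ k := by exact_mod_cast hk
  have hpos : (0 : ℝ) < 2 * k + 1 := by linarith
  -- This constant makes the odd cycle inequality tight at length `2 * k + 1`. So each stable set
  -- used has exactly `k ≥ 1` vertices on such a cycle, and none survives the deletion.
  let x : V → ℝ := fun _ => k / (2 * k + 1)
  have hx : x ∈ G.tStab := by
    refine mem_tStab_of_support (fun v => ⟨by positivity, ?_⟩) (fun u v _ => ?_) ?_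
    · rw [div_le_one hpos]; linarith
    · simp only [x]; rw [← add_div, div_le_one hpos]; linarith
    · intro u c hc ho _
      have h1 : ((2 * k + 1 : ℕ) : ℝ) ≤ c.length := by exact_mod_cast hodd u c hc ho
      push_cast at h1
      simp only [x, Finset.sum_const, Finset.card_range, nsmul_eq_mul]
      rw [mul_div_assoc', div_le_div_iff₀ hpos (by norm_num)]
      nlinarith
  obtain ⟨ι, _, w, S, hw, hw1, hS, hxe⟩ := exists_stable_combination (hG hx)
  have hne : Nonempty ι := by
    by_contra h
    rw [not_nonempty_iff] at h
    simp at hw1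
  obtain ⟨i⟩ := hne
  refine ⟨S i, hS i, fun u c hc ho => ?_⟩
  set d := c.map (Embedding.induce (G := G) (S i)ᶜ).toHom with hd
  have hdc : d.IsCycle := hc.map (Embedding.induce (G := G) (S i)ᶜ).injective
  have hdl : d.length = c.length := Walk.length_map _ c
  have hge := hodd _ d hdc (by rw [hdl]; exact ho)
  have h3 := hdc.three_le_length
  rcases hge.lt_or_eq with h | h
  · rw [hdl] at h; obtain ⟨m, hm⟩ := ho; omega
  exfalso
  have hN : Odd d.length := by rw [hdl]; exact ho
  have hle : ∀ j, ∑ n ∈ Finset.range d.length, (S j).indicator (1 : V → ℝ) (d.getVert n) ≤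
      (k : ℝ) := by
    intro j
    have := sum_indicator_le (hS j) (o := d.getVert) hN
      (fun n hn => d.adj_getVert_succ (by omega)) (by
        have := d.adj_getVert_succ (i := d.length - 1) (by omega)
        have e : d.length - 1 + 1 = d.length := by omega
        rw [e, d.getVert_length] at this
        rwa [d.getVert_zero])
    rw [← h] at this
    rw [← h]
    push_cast at this
    linarith
  have hsum : ∑ j, w j * ∑ n ∈ Finset.range d.length,
      (S j).indicator (1 : V → ℝ) (d.getVert n) = k := by
    simp only [Finset.mul_sum]
    rw [Finset.sum_comm]
    simp only [← hxe]
    simp only [x, Finset.sum_const, Finset.card_range, nsmul_eq_mul, ← h]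
    push_cast
    field_simp
  have := eq_of_weighted_sum_eq hw hw1 hle hsum i
  rw [Finset.sum_eq_zero] at this
  · linarith
  · intro n hn
    have : d.getVert n ∉ S i := by
      rw [hd, Walk.getVert_map]
      exact (c.getVert n).2
    exact Set.indicator_of_notMem this _

/-! ### Induced odd cycles and bipartite hubs -/

/-- The vertices `o 0, …, o (N - 1)` form an induced cycle, in this order. -/
structure IsInducedCycle (G : SimpleGraph V) (o : ℕ → V) (N : ℕ) : Prop where
  ne : ∀ i j, i < j → j < N → o i ≠ o j
  adj_iff : ∀ i j, i < j → j < N → (G.Adj (o i) (o j) ↔ j = i + 1 ∨ (i = 0 ∧ j + 1 = N))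

theorem sum_range_shift {M : Type*} [AddCommMonoid M] {g : ℕ → M} {L : ℕ} (h : g L = g 0) :
    ∑ i ∈ Finset.range L, g (i + 1) = ∑ i ∈ Finset.range L, g i := by
  cases L with
  | zero => simp
  | succ L => rw [Finset.sum_range_succ, h, Finset.sum_range_succ' g]

/-- A closed odd walk inside an induced odd cycle visits the whole cycle. -/
theorem IsInducedCycle.exists_eq_of_odd_closed {o : ℕ → V} {N : ℕ} (ho : G.IsInducedCycle o N)
    (hN : Odd N) {v : ℕ → V} {L : ℕ} (hL : Odd L) (hv0 : v L = v 0)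
    (hadj : ∀ i < L, G.Adj (v i) (v (i + 1))) (hO : ∀ i ≤ L, ∃ j < N, v i = o j)
    {j : ℕ} (hj : j < N) : ∃ i < L, v i = o j := by
  classical
  by_contra hcon
  push Not at hcon
  choose! g hgN hg using hO
  have hgj : ∀ i ≤ L, g i ≠ j := by
    intro i hi h
    rcases hi.lt_or_eq with hl | hl
    · exact hcon i hl (by rw [hg i hi, h])
    · exact hcon 0 (by grind) (by rw [← hv0, ← hl, hg i hi, h])
  have hinj : ∀ a b, a < N → b < N → o a = o b → a = b := by
    intro a b ha hb h
    rcases lt_trichotomy a b with h' | h' | h'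
    · exact absurd h (ho.ne _ _ h' hb)
    · exact h'
    · exact absurd h.symm (ho.ne _ _ h' ha)
  -- If `o j` is missed, the walk lives on a path. The shift after `j` turns the index into a proper
  -- 2-colouring, because `N` is odd and so the edge from `o (N - 1)` to `o 0` also gets an odd sum.
  let κ : ℕ → ℕ := fun i => if g i < j then g i else g i + 1
  have hκ : ∀ i < L, Odd (κ i + κ (i + 1)) := by
    intro i hi
    have h1 := hadj i hi
    rw [hg i hi.le, hg (i + 1) hi] at h1
    have n1 := hgN i hi.le
    have n2 := hgN (i + 1) hi
    have j1 := hgj i hi.le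
    have j2 := hgj (i + 1) hi
    rcases lt_trichotomy (g i) (g (i + 1)) with h | h | h
    · have := (ho.adj_iff _ _ h n2).1 h1
      simp only [κ]
      split_ifs <;> grind
    · rw [h] at h1; exact absurd rfl h1.ne
    · have := (ho.adj_iff _ _ h n1).1 h1.symm
      simp only [κ]
      split_ifs <;> grind
  have hκL : κ L = κ 0 := by
    have : g L = g 0 := hinj _ _ (hgN L le_rfl) (hgN 0 (by omega)) (by
      rw [← hg L le_rfl, ← hg 0 (by omega), hv0])
    simp only [κ, this]
  have hs := sum_range_shift (g := κ) hκL
  have hodd : Odd (∑ i ∈ Finset.range L, (κ i + κ (i + 1))) := by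
    rw [Finset.odd_sum_iff_odd_card_odd]
    rw [Finset.filter_true_of_mem (fun i hi => hκ i (Finset.mem_range.1 hi))]
    simpa using hL
  rw [Finset.sum_add_distrib, hs] at hodd
  grind

/-- The counting behind the odd cycle inequalities for a cycle together with a bipartite hub:
`a`, `b`, `o` are the numbers of visits of a closed odd walk to the three parts. -/
theorem hub_count {α β ω : ℕ → ℤ} {L : ℕ} (hL : Odd L)
    (hα : ∀ i, α i = 0 ∨ α i = 1) (hβ : ∀ i, β i = 0 ∨ β i = 1)
    (h1 : ∀ i ≤ L, α i + β i + ω i = 1) (hω : ∀ i ≤ L, 0 ≤ ω i)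
    (hαL : α L = α 0) (hβL : β L = β 0) (hωL : ω L = ω 0)
    (hαβ : ∀ i < L, α i ≤ β (i + 1)) (hβα : ∀ i < L, α (i + 1) ≤ β i)
    (hββ : ∀ i < L, β i + β (i + 1) ≤ 1) :
    (∀ i ≤ L, ω i = 1) ∨
    (∑ i ∈ Finset.range L, α i + 1 ≤ ∑ i ∈ Finset.range L, β i ∧
      2 ≤ ∑ i ∈ Finset.range L, ω i) ∨
    (∑ i ∈ Finset.range L, α i + 2 ≤ ∑ i ∈ Finset.range L, β i ∧
      1 ≤ ∑ i ∈ Finset.range L, ω i) := by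
  set a := ∑ i ∈ Finset.range L, α i with ha
  set b := ∑ i ∈ Finset.range L, β i with hb
  set w := ∑ i ∈ Finset.range L, ω i with hw
  have sα := sum_range_shift hαL
  have sβ := sum_range_shift hβL
  have hab : a ≤ b := by
    rw [hb, ← sβ]
    exact Finset.sum_le_sum fun i hi => hαβ i (Finset.mem_range.1 hi)
  have htot : a + b + w = L := by
    rw [ha, hb, hw, ← Finset.sum_add_distrib, ← Finset.sum_add_distrib,
      Finset.sum_congr rfl (fun i hi => h1 i (Finset.mem_range.1 hi).le)]
    simp
  have h2b : 2 * b ≤ L := by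
    have : b + b ≤ L := by
      nth_rw 2 [hb]
      rw [← sβ, hb, ← Finset.sum_add_distrib]
      calc _ ≤ ∑ i ∈ Finset.range L, (1 : ℤ) :=
            Finset.sum_le_sum fun i hi => hββ i (Finset.mem_range.1 hi)
        _ = L := by simp
    omega
  have hw0 : 0 ≤ w := Finset.sum_nonneg fun i hi => hω i (Finset.mem_range.1 hi).le
  obtain ⟨l, hl⟩ := hL
  -- If `a < b`, then `2 * b ≤ L` excludes `w = 0`, and `w = 1` makes `b - a` even, hence at least
  -- 2. If `a = b`, every visit to one side of the hub is preceded and followed by the other side,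
  -- so the walk never passes between hub and cycle; it is not inside the hub because `L` is odd.
  rcases hab.lt_or_eq with hlt | heq
  · right
    have : w ≠ 0 := by omega
    by_cases hw1 : w = 1
    · right; omega
    · left; omega
  · left
    have e1 : ∀ i ∈ Finset.range L, α i = β (i + 1) := by
      refine (Finset.sum_eq_sum_iff_of_le (fun i hi => hαβ i (Finset.mem_range.1 hi))).1 ?_
      rw [sβ]; exact heq
    have e2 : ∀ i ∈ Finset.range L, α (i + 1) = β i := by
      refine (Finset.sum_eq_sum_iff_of_le (fun i hi => hβα i (Finset.mem_range.1 hi))).1 ?_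
      rw [sα]; exact heq
    have step : ∀ i < L, ω i = 1 → ω (i + 1) = 1 := by
      intro i hi h
      have := e1 i (Finset.mem_range.2 hi)
      have := e2 i (Finset.mem_range.2 hi)
      have := h1 i hi.le
      have := h1 (i + 1) hi
      rcases hα i with h | h <;> rcases hβ i with h' | h' <;> omega
    have up : ∀ i j, i ≤ j → j ≤ L → ω i = 1 → ω j = 1 := by
      intro i j hij hj h
      induction j, hij using Nat.le_induction with
      | base => exact h
      | succ j hij ih => exact step j hj (ih (by omega))
    have hpos : ∃ i ∈ Finset.range L, 0 < ω i := by
      by_contra hcon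
      push Not at hcon
      have : w ≤ 0 := Finset.sum_nonpos hcon
      omega
    obtain ⟨i, hi, hi0⟩ := hpos
    have hi' := (Finset.mem_range.1 hi)
    have hi1 : ω i = 1 := by
      have := h1 i hi'.le
      rcases hα i with h | h <;> rcases hβ i with h' | h' <;> omega
    have h0 : ω 0 = 1 := by rw [← hωL]; exact up i L hi'.le le_rfl hi1
    intro j hj
    exact up 0 j (Nat.zero_le _) hj h0

/-- In a t-perfect graph no connected bipartite hub attaches, on one side of its bipartition only,
to an induced odd cycle in three vertices that cut the cycle into odd arcs. -/
theorem false_of_hub (hG : G.tStab ⊆ G.stableSetPolytope) {o : ℕ → V} {N p q r : ℕ} (hN : Odd N)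
    (ho : G.IsInducedCycle o N) (hpq : p < q) (hqr : q < r) (hr : r < N) (h1 : Odd (q - p))
    (h2 : Odd (r - q)) {A B : Set V} (hA : G.IsIndepSet A) (hB : G.IsIndepSet B)
    (hAB : Disjoint A B) (hconn : (G.induce (A ∪ B)).Preconnected)
    (hOA : ∀ i < N, o i ∉ A) (hOB : ∀ i < N, o i ∉ B)
    (hAO : ∀ i < N, ∀ a ∈ A, ¬ G.Adj a (o i)) (hp : ∃ b ∈ B, G.Adj b (o p))
    (hq : ∃ b ∈ B, G.Adj b (o q)) (hr' : ∃ b ∈ B, G.Adj b (o r)) : False := by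
  classical
  have hN3 : (3 : ℝ) ≤ N := by exact_mod_cast (by omega : 3 ≤ N)
  have hNpos : (0 : ℝ) < N := by linarith
  let O : Set V := {v | ∃ i < N, v = o i}
  have hOA' : ∀ v ∈ O, v ∉ A := by rintro v ⟨i, hi, rfl⟩; exact hOA i hi
  have hOB' : ∀ v ∈ O, v ∉ B := by rintro v ⟨i, hi, rfl⟩; exact hOB i hi
  have hAB' : ∀ v ∈ A, v ∉ B := fun v h h' => Set.disjoint_left.1 hAB h h'
  -- The values sum to 1 on each edge between `A` and `B`, and to `(N - 1) / 2` on the cycle.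
  let x : V → ℝ := fun v => if v ∈ A then (N - 1) / N else if v ∈ B then 1 / N
    else if v ∈ O then (N - 1) / (2 * N) else 0
  have xA : ∀ v ∈ A, x v = (N - 1) / N := fun v h => by simp [x, h]
  have xB : ∀ v ∈ B, x v = 1 / N := fun v h => by
    have : v ∉ A := fun h' => hAB' v h' h
    simp [x, h, this]
  have xO : ∀ v ∈ O, x v = (N - 1) / (2 * N) := fun v h => by
    simp only [x, hOA' v h, hOB' v h, h, if_true, if_false]
  have x0 : ∀ v, v ∉ A → v ∉ B → v ∉ O → x v = 0 := fun v h h' h'' => by simp [x, h, h', h'']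
  have eA : ((N : ℝ) - 1) / N = 1 - 1 / N := by field_simp
  have eO : ((N : ℝ) - 1) / (2 * N) = 1 / 2 - 1 / N / 2 := by field_simp
  have hinv0 : (0 : ℝ) < 1 / N := by positivity
  have hinv : (1 : ℝ) / N ≤ 1 / 3 := one_div_le_one_div_of_le (by norm_num) hN3
  have hcase : ∀ v, v ∈ A ∨ v ∈ B ∨ v ∈ O ∨ (v ∉ A ∧ v ∉ B ∧ v ∉ O) := by
    intro v; by_cases h : v ∈ A <;> by_cases h' : v ∈ B <;> by_cases h'' : v ∈ O <;> simp [*]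
  have hb : ∀ v, 0 ≤ x v ∧ x v ≤ 1 := by
    intro v
    rcases hcase v with h | h | h | h
    · rw [xA v h, eA]; constructor <;> linarith
    · rw [xB v h]; constructor <;> linarith
    · rw [xO v h, eO]; constructor <;> linarith
    · rw [x0 v h.1 h.2.1 h.2.2]; norm_num
  have hmem : x ∈ G.tStab := by
    refine mem_tStab_of_support hb ?_ ?_
    · intro u v huv
      rcases hcase u with h | h | h | h <;> rcases hcase v with h' | h' | h' | h'
      · exact absurd huv (hA h h' huv.ne)
      · rw [xA u h, xB v h', eA]; linarith
      · obtain ⟨i, hi, rfl⟩ := h'; exact absurd huv (hAO i hi u h)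
      · rw [x0 v h'.1 h'.2.1 h'.2.2]; linarith [(hb u).2]
      · rw [xB u h, xA v h', eA]; linarith
      · exact absurd huv (hB h h' huv.ne)
      · rw [xB u h, xO v h', eO]; linarith
      · rw [x0 v h'.1 h'.2.1 h'.2.2]; linarith [(hb u).2]
      · obtain ⟨i, hi, rfl⟩ := h; exact absurd huv.symm (hAO i hi v h')
      · rw [xO u h, xB v h', eO]; linarith
      · rw [xO u h, xO v h', eO]; linarith
      · rw [x0 v h'.1 h'.2.1 h'.2.2]; linarith [(hb u).2]
      all_goals rw [x0 u h.1 h.2.1 h.2.2]; linarith [(hb v).2]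
    · intro u c hc hodd hs
      have h3 := hc.three_le_length
      set L := c.length with hLdef
      set v := c.getVert with hv
      have hvadj : ∀ i < L, G.Adj (v i) (v (i + 1)) := fun i hi => c.adj_getVert_succ hi
      have hvL : v L = v 0 := by simp [hv, hLdef]
      have hsup : ∀ i, v i ∈ A ∨ v i ∈ B ∨ v i ∈ O := by
        intro i
        by_contra hcon
        push Not at hcon
        exact hs (v i) (c.getVert_mem_support i) (x0 _ hcon.1 hcon.2.1 hcon.2.2)
      let α : ℕ → ℤ := fun i => if v i ∈ A then 1 else 0
      let β : ℕ → ℤ := fun i => if v i ∈ B then 1 else 0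
      let ω : ℕ → ℤ := fun i => if v i ∈ O then 1 else 0
      have hsplit : ∀ i, α i + β i + ω i = 1 := by
        intro i
        simp only [α, β, ω]
        rcases hsup i with h | h | h
        · simp [h, hAB' _ h, show v i ∉ O from fun h' => hOA' _ h' h]
        · simp [h, show v i ∉ A from fun h' => hAB' _ h' h, show v i ∉ O from fun h' => hOB' _ h' h]
        · simp [h, hOA' _ h, hOB' _ h]
      have nbrA : ∀ u w, G.Adj u w → u ∈ A → (w ∈ A ∨ w ∈ B ∨ w ∈ O) → w ∈ B := by
        intro u w huw hu hw
        rcases hw with h | h | h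
        · exact absurd huw (hA hu h huw.ne)
        · exact h
        · obtain ⟨i, hi, rfl⟩ := h; exact absurd huw (hAO i hi u hu)
      have hxv : ∀ i, x (v i) = 1 / 2 + α i * (1 / 2 - 1 / N) - β i * (1 / 2 - 1 / N)
          - ω i * (1 / N / 2) := by
        intro i
        simp only [α, β, ω]
        rcases hsup i with h | h | h
        · rw [xA _ h, eA]
          simp [h, hAB' _ h, show v i ∉ O from fun h' => hOA' _ h' h]; ring
        · rw [xB _ h]
          simp [h, show v i ∉ A from fun h' => hAB' _ h' h, show v i ∉ O from fun h' => hOB' _ h' h]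
        · rw [xO _ h, eO]
          simp [h, hOA' _ h, hOB' _ h]
      have hsum : ∑ i ∈ Finset.range L, x (v i) = L / 2
          + (∑ i ∈ Finset.range L, α i : ℤ) * (1 / 2 - 1 / N)
          - (∑ i ∈ Finset.range L, β i : ℤ) * (1 / 2 - 1 / N)
          - (∑ i ∈ Finset.range L, ω i : ℤ) * (1 / N / 2) := by
        simp only [hxv, Finset.sum_add_distrib, Finset.sum_sub_distrib, ← Finset.sum_mul]
        push_cast
        simp
        ring
      have hcount := hub_count (α := α) (β := β) (ω := ω) hodd
        (fun i => by simp only [α]; split_ifs <;> simp)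
        (fun i => by simp only [β]; split_ifs <;> simp)
        (fun i _ => hsplit i) (fun i _ => by simp only [ω]; split_ifs <;> simp)
        (by simp only [α, hvL]) (by simp only [β, hvL]) (by simp only [ω, hvL])
        (fun i hi => by
          simp only [α, β]
          by_cases h : v i ∈ A
          · simp [h, nbrA _ _ (hvadj i hi) h (hsup _)]
          · simp only [h, if_false]; split_ifs <;> simp)
        (fun i hi => by
          simp only [α, β]
          by_cases h : v (i + 1) ∈ A
          · simp [h, nbrA _ _ (hvadj i hi).symm h (hsup _)]
          · simp only [h, if_false]; split_ifs <;> simp)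
        (fun i hi => by
          simp only [β]
          by_cases h : v i ∈ B
          · have : v (i + 1) ∉ B := fun h' => hB h h' (hvadj i hi).ne (hvadj i hi)
            simp [h, this]
          · simp only [h, if_false]; split_ifs <;> simp)
      rw [hsum]
      -- With `a`, `b`, `w` visits to the three parts, the sum is `L/2 - (b - a)(1/2 - 1/N) -
      -- w/(2N)`. Each alternative makes the loss at least 1/2; in the first one because the walk
      -- covers the cycle, so `N ≤ L`.
      rcases hcount with hO | ⟨hab, hw⟩ | ⟨hab, hw⟩
      · have hvO : ∀ i ≤ L, ∃ j < N, v i = o j := by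
          intro i hi
          have := hO i hi
          simp only [ω] at this
          by_contra hcon
          rw [if_neg] at this
          · omega
          · exact hcon
        have hNL : N ≤ L := by
          have hsub : (Finset.range N).image o ⊆ (Finset.range L).image v := by
            intro y hy
            obtain ⟨j, hj, rfl⟩ := Finset.mem_image.1 hy
            obtain ⟨i, hi, he⟩ := ho.exists_eq_of_odd_closed hN hodd hvL hvadj hvO
              (Finset.mem_range.1 hj)
            exact Finset.mem_image.2 ⟨i, Finset.mem_range.2 hi, he⟩
          have hcard := Finset.card_le_card hsub
          rw [Finset.card_image_of_injOn] at hcard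
          · simpa using hcard.trans Finset.card_image_le
          · intro i hi j hj hij
            simp only [Finset.coe_range, Set.mem_Iio] at hi hj
            rcases lt_trichotomy i j with h | h | h
            · exact absurd hij (ho.ne _ _ h hj)
            · exact h
            · exact absurd hij.symm (ho.ne _ _ h hi)
        have z1 : ∑ i ∈ Finset.range L, α i = 0 := Finset.sum_eq_zero fun i hi => by
          obtain ⟨j, hj, he⟩ := hvO i (Finset.mem_range.1 hi).le
          simp [α, he, hOA j hj]
        have z2 : ∑ i ∈ Finset.range L, β i = 0 := Finset.sum_eq_zero fun i hi => by
          obtain ⟨j, hj, he⟩ := hvO i (Finset.mem_range.1 hi).le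
          simp [β, he, hOB j hj]
        have z3 : ∑ i ∈ Finset.range L, ω i = L := by
          rw [Finset.sum_congr rfl fun i hi => hO i (Finset.mem_range.1 hi).le]; simp
        rw [z1, z2, z3]
        have : (1 : ℝ) ≤ L * (1 / N) := by
          rw [mul_one_div, le_div_iff₀ hNpos, one_mul]; exact_mod_cast hNL
        push_cast
        linarith
      · have hab' : ((∑ i ∈ Finset.range L, α i : ℤ) : ℝ) + 1 ≤ (∑ i ∈ Finset.range L, β i : ℤ) := by
          exact_mod_cast hab
        have hw' : (2 : ℝ) ≤ (∑ i ∈ Finset.range L, ω i : ℤ) := by exact_mod_cast hw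
        nlinarith
      · have hab' : ((∑ i ∈ Finset.range L, α i : ℤ) : ℝ) + 2 ≤ (∑ i ∈ Finset.range L, β i : ℤ) := by
          exact_mod_cast hab
        have hw' : (1 : ℝ) ≤ (∑ i ∈ Finset.range L, ω i : ℤ) := by exact_mod_cast hw
        nlinarith
  obtain ⟨ι, _, w, S, hw, hw1, hS, hxe⟩ := exists_stable_combination (hG hmem)
  obtain ⟨b₀, hb₀, hb₀p⟩ := hp
  have hedge : ∀ i, ∀ u v, u ∈ A → v ∈ B → G.Adj u v → (u ∈ S i ↔ v ∉ S i) := by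
    intro i u v hu hv huv
    have := eq_of_weighted_sum_eq hw hw1 (fun j => indicator_add_le (hS j) huv) (by
      simp only [mul_add, Finset.sum_add_distrib, ← hxe]
      rw [xA u hu, xB v hv, eA]; ring) i
    by_cases h : u ∈ S i <;> by_cases h' : v ∈ S i <;> simp [h, h'] at this ⊢
  obtain ⟨i, hi⟩ : ∃ i, b₀ ∈ S i := by
    by_contra hcon
    push Not at hcon
    have := hxe b₀
    rw [xB _ hb₀, Finset.sum_eq_zero (fun i _ => by simp [hcon i])] at this
    linarith
  -- Exactly one end of each hub edge is in `S i`, so membership of `b₀` determines `S i` on the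
  -- connected hub.
  have hBS : ∀ v ∈ A ∪ B, (v ∈ S i ↔ v ∈ B) := by
    have hreach : ∀ (u v : ↑(A ∪ B)), (G.induce (A ∪ B)).Walk u v →
        ((u : V) ∈ S i ↔ (u : V) ∈ B) → ((v : V) ∈ S i ↔ (v : V) ∈ B) := by
      intro u v W
      induction W with
      | nil => exact id
      | @cons u v w huv _ ih =>
        intro hu
        apply ih
        have huv' : G.Adj (u : V) (v : V) := huv
        rcases u.2 with h | h <;> rcases v.2 with h' | h'
        · exact absurd huv' (hA h h' huv'.ne)
        · have := hedge i _ _ h h' huv'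
          have := hAB' _ h
          tauto
        · have := hedge i _ _ h' h huv'.symm
          have := hAB' _ h'
          tauto
        · exact absurd huv' (hB h h' huv'.ne)
    intro v hv
    obtain ⟨W⟩ := hconn ⟨b₀, Or.inr hb₀⟩ ⟨v, hv⟩
    exact hreach _ _ W (by simp [hi, hb₀])
  have hcycadj : ∀ j, j + 1 < N → G.Adj (o j) (o (j + 1)) := fun j hj =>
    (ho.adj_iff j (j + 1) (by omega) hj).2 (Or.inl rfl)
  have hcycw : G.Adj (o (N - 1)) (o 0) :=
    ((ho.adj_iff 0 (N - 1) (by omega) (by omega)).2 (Or.inr ⟨rfl, by omega⟩)).symm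
  have htight := eq_of_weighted_sum_eq hw hw1 (fun j => sum_indicator_le (hS j) hN hcycadj hcycw)
    (by
      simp only [Finset.mul_sum]
      rw [Finset.sum_comm]
      simp only [← hxe]
      rw [Finset.sum_congr rfl fun j hj => xO (o j) ⟨j, Finset.mem_range.1 hj, rfl⟩]
      simp only [Finset.sum_const, Finset.card_range, nsmul_eq_mul]
      field_simp) i
  have hzero : ∀ j, (∃ b ∈ B, G.Adj b (o j)) → (S i).indicator (1 : V → ℝ) (o j) ≤ 0 := by
    rintro j ⟨b, hb, hbj⟩
    have hbS : b ∈ S i := (hBS b (Or.inr hb)).2 hb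
    have : o j ∉ S i := fun h => hS i hbS h hbj.ne hbj
    simp [this]
  have := sum_range_odd_le_of_three_zeros (y := fun j => (S i).indicator (1 : V → ℝ) (o j)) hN hpq hqr hr h1 h2
    (fun j hj => indicator_add_le (hS i) (hcycadj j hj)) (indicator_add_le (hS i) hcycw)
    (hzero p ⟨b₀, hb₀, hb₀p⟩) (hzero q hq) (hzero r hr')
  rw [htight] at this
  linarith

/-! ### Colourings of vertex sets -/

/-- The subgraph induced on `X` is `n`-colourable. -/
def ColOn (G : SimpleGraph V) (n : ℕ) (X : Set V) : Prop :=
  ∃ f : V → ℕ, (∀ x ∈ X, f x < n) ∧ ∀ x ∈ X, ∀ y ∈ X, G.Adj x y → f x ≠ f y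

theorem ColOn.mono {n m : ℕ} {X Y : Set V} (h : G.ColOn n Y) (hX : X ⊆ Y) (hn : n ≤ m) :
    G.ColOn m X := by
  obtain ⟨f, h1, h2⟩ := h
  exact ⟨f, fun x hx => (h1 x (hX hx)).trans_le hn, fun x hx y hy => h2 x (hX hx) y (hX hy)⟩

theorem ColOn.union {n m : ℕ} {X Y : Set V} (hX : G.ColOn n X) (hY : G.ColOn m Y) :
    G.ColOn (n + m) (X ∪ Y) := by
  classical
  obtain ⟨f, h1, h2⟩ := hX
  obtain ⟨g, h3, h4⟩ := hY
  refine ⟨fun v => if v ∈ X then f v else n + g v, ?_, ?_⟩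
  · rintro x hx
    dsimp only
    split_ifs with h
    · have := h1 x h; omega
    · have := h3 x (hx.resolve_left h); omega
  · intro x hx y hy hxy
    dsimp only
    split_ifs with h h' h'
    · exact h2 x h y h' hxy
    · have := h1 x h; omega
    · have := h1 y h'; omega
    · have := h4 x (hx.resolve_left h) y (hy.resolve_left h') hxy
      omega

theorem not_colOn_diff {n m : ℕ} {X Y : Set V} (hX : ¬ G.ColOn (n + m) X) (hY : G.ColOn m Y) :
    ¬ G.ColOn n (X \ Y) := fun h => hX ((h.union hY).mono (by simp) le_rfl)

theorem nonempty_of_not_colOn {n : ℕ} {X : Set V} (hX : ¬ G.ColOn n X) : X.Nonempty := by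
  by_contra h
  rw [Set.not_nonempty_iff_eq_empty] at h
  subst h
  exact hX ⟨fun _ => 0, by simp, by simp⟩

theorem exists_adj_of_not_colOn_one {X : Set V} (hX : ¬ G.ColOn 1 X) :
    ∃ u ∈ X, ∃ v ∈ X, G.Adj u v := by
  by_contra h
  push Not at h
  exact hX ⟨fun _ => 0, by simp, fun x hx y hy hxy => absurd hxy (h x hx y hy)⟩

theorem ColOn.colorable {n : ℕ} (h : G.ColOn n Set.univ) : G.Colorable n := by
  obtain ⟨f, h1, h2⟩ := h
  exact ⟨Coloring.mk (fun v => (⟨f v, h1 v trivial⟩ : Fin n)) fun {v w} hvw h => h2 v trivial w trivial hvw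
    (by simpa using h)⟩

theorem colOn_of_colorable_induce {n : ℕ} {X : Set V} (h : (G.induce X).Colorable n) :
    G.ColOn n X := by
  classical
  obtain ⟨C⟩ := h
  refine ⟨fun v => if h : v ∈ X then C ⟨v, h⟩ else 0, ?_, ?_⟩
  · intro x hx; simp [hx]
  · intro x hx y hy hxy
    have := C.valid (v := ⟨x, hx⟩) (w := ⟨y, hy⟩) hxy
    simp only [hx, hy, dif_pos]
    exact fun h => this (Fin.ext h)

/-- If a function changes by at most one along edges, some fibre needs at least half of the
colours. -/
theorem exists_fibre_not_colOn {n : ℕ} {X : Set V} {f : V → ℕ}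
    (hf : ∀ x ∈ X, ∀ y ∈ X, G.Adj x y → f x ≤ f y + 1) (hX : ¬ G.ColOn (2 * n) X) :
    ∃ k, ¬ G.ColOn n {x ∈ X | f x = k} := by
  by_contra hcon
  push Not at hcon
  choose g hg1 hg2 using hcon
  apply hX
  refine ⟨fun v => n * (f v % 2) + g (f v) v, ?_, ?_⟩
  · intro x hx
    have := hg1 (f x) x ⟨hx, rfl⟩
    rcases Nat.mod_two_eq_zero_or_one (f x) with h | h <;> simp only [h] <;> omega
  · intro x hx y hy hxy
    have h1 := hg1 (f x) x ⟨hx, rfl⟩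
    have h2 := hg1 (f y) y ⟨hy, rfl⟩
    have h3 := hf x hx y hy hxy
    have h4 := hf y hy x hx hxy.symm
    by_cases h : f x = f y
    · have := hg2 (f x) x ⟨hx, rfl⟩ y ⟨hy, h.symm⟩ hxy
      dsimp only; rw [← h]; omega
    · have : f x % 2 ≠ f y % 2 := by omega
      rcases Nat.mod_two_eq_zero_or_one (f x) with h | h <;>
        rcases Nat.mod_two_eq_zero_or_one (f y) with h' | h' <;> simp only [h, h'] <;> omega

theorem exists_parity_not_colOn {n : ℕ} {X : Set V} (f : V → ℕ) (hX : ¬ G.ColOn (2 * n) X) :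
    ∃ k, ¬ G.ColOn n {x ∈ X | f x % 2 = k} := by
  by_contra hcon
  push Not at hcon
  refine hX (((hcon 0).union (hcon 1)).mono ?_ (by omega))
  intro x hx
  rcases Nat.mod_two_eq_zero_or_one (f x) with h | h
  · exact Or.inl ⟨hx, h⟩
  · exact Or.inr ⟨hx, h⟩

/-! ### Connected vertex sets -/

/-- `y` can be reached from `x` by a walk all of whose later vertices lie in `X`. -/
def ReachIn (G : SimpleGraph V) (X : Set V) : V → V → Prop :=
  Relation.ReflTransGen fun a b => G.Adj a b ∧ b ∈ X

/-- `X` induces a connected (or empty) subgraph. -/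
def ConnOn (G : SimpleGraph V) (X : Set V) : Prop :=
  ∀ x ∈ X, ∀ y ∈ X, G.ReachIn X x y

theorem ReachIn.mono {X Y : Set V} (hXY : X ⊆ Y) {x y : V} (h : G.ReachIn X x y) :
    G.ReachIn Y x y := by
  induction h with
  | refl => exact Relation.ReflTransGen.refl
  | tail _ h ih => exact Relation.ReflTransGen.tail ih ⟨h.1, hXY h.2⟩

theorem ReachIn.trans {X : Set V} {x y z : V} (h : G.ReachIn X x y) (h' : G.ReachIn X y z) :
    G.ReachIn X x z := Relation.ReflTransGen.trans h h'

theorem ReachIn.mem {X : Set V} {x y : V} (h : G.ReachIn X x y) (hx : x ∈ X) : y ∈ X := by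
  induction h with
  | refl => exact hx
  | tail _ h _ => exact h.2

theorem ReachIn.symm {X : Set V} {x y : V} (h : G.ReachIn X x y) (hx : x ∈ X) :
    G.ReachIn X y x := by
  induction h with
  | refl => exact Relation.ReflTransGen.refl
  | @tail b c hb hbc ih =>
    exact Relation.ReflTransGen.head ⟨hbc.1.symm, ReachIn.mem hb hx⟩ ih

theorem connOn_of_reach {X : Set V} {c : V} (hc : c ∈ X) (h : ∀ x ∈ X, G.ReachIn X c x) :
    G.ConnOn X := fun x hx y hy => ((h x hx).symm hc).trans (h y hy)

theorem ConnOn.union {X Y : Set V} (hX : G.ConnOn X) (hY : G.ConnOn Y) {z : V} (hzX : z ∈ X)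
    (hzY : z ∈ Y) : G.ConnOn (X ∪ Y) := by
  refine connOn_of_reach (Or.inl hzX) ?_
  rintro x (hx | hx)
  · exact (hX z hzX x hx).mono Set.subset_union_left
  · exact (hY z hzY x hx).mono Set.subset_union_right

theorem ConnOn.insert_of_adj {X : Set V} (hX : G.ConnOn X) {c x : V} (hx : x ∈ X)
    (h : G.Adj c x) : G.ConnOn (insert c X) := by
  refine connOn_of_reach (Set.mem_insert _ _) ?_
  rintro y (rfl | hy)
  · exact Relation.ReflTransGen.refl
  · exact Relation.ReflTransGen.head ⟨h, Or.inr hx⟩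
      ((hX x hx y hy).mono (Set.subset_insert _ _))

/-- The vertices of a walk form a connected set. -/
theorem connOn_range {τ : ℕ → V} {n : ℕ} (h : ∀ i < n, G.Adj (τ i) (τ (i + 1))) :
    G.ConnOn {x | ∃ i ≤ n, x = τ i} := by
  refine connOn_of_reach (c := τ 0) ⟨0, Nat.zero_le _, rfl⟩ ?_
  rintro x ⟨i, hi, rfl⟩
  induction i with
  | zero => exact Relation.ReflTransGen.refl
  | succ i ih =>
    exact Relation.ReflTransGen.tail (ih (by omega)) ⟨h i (by omega), i + 1, hi, rfl⟩

theorem ReachIn.exists_exit {X C : Set V} {x y : V} (h : G.ReachIn X x y) (hx : x ∈ C)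
    (hy : y ∉ C) : ∃ a ∈ C, ∃ b ∈ X, b ∉ C ∧ G.Adj a b := by
  induction h with
  | refl => exact absurd hx hy
  | @tail b c _ hbc ih =>
    by_cases hb : b ∈ C
    · exact ⟨b, hb, c, hbc.2, hy, hbc.1⟩
    · exact ih hb

/-- A set that needs many colours has a component that does. -/
theorem exists_component_not_colOn {n : ℕ} {X : Set V} (hX : ¬ G.ColOn n X) :
    ∃ C ⊆ X, G.ConnOn C ∧ ¬ G.ColOn n C ∧ ∀ x ∈ C, ∀ y ∈ X, G.Adj x y → y ∈ C := by
  classical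
  let comp : V → Set V := fun v => {y | y ∈ X ∧ G.ReachIn X v y}
  have hclosed : ∀ v, ∀ x ∈ comp v, ∀ y ∈ X, G.Adj x y → y ∈ comp v := fun v x hx y hy hxy =>
    ⟨hy, Relation.ReflTransGen.tail hx.2 ⟨hxy, hy⟩⟩
  have hconn : ∀ v ∈ X, G.ConnOn (comp v) := by
    intro v hv
    have key : ∀ y, G.ReachIn X v y → G.ReachIn (comp v) v y := by
      intro y hy
      induction hy with
      | refl => exact Relation.ReflTransGen.refl
      | @tail b c hb hbc ih =>
        exact Relation.ReflTransGen.tail ih ⟨hbc.1, hbc.2, Relation.ReflTransGen.tail hb hbc⟩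
    exact connOn_of_reach ⟨hv, Relation.ReflTransGen.refl⟩ fun x hx => key x hx.2
  by_contra hcon
  push Not at hcon
  have hcol : ∀ v ∈ X, G.ColOn n (comp v) := by
    intro v hv
    by_contra h
    obtain ⟨x, hx, y, hy, hxy, hyc⟩ := hcon (comp v) (fun y hy => hy.1) (hconn v hv) h
    exact hyc (hclosed v x hx y hy hxy)
  -- The colouring is chosen per component as a set, so that adjacent vertices are coloured by the
  -- same function.
  have hcol' : ∀ C : Set V, ∃ f : V → ℕ, (∃ v ∈ X, C = comp v) →
      (∀ x ∈ C, f x < n) ∧ ∀ x ∈ C, ∀ y ∈ C, G.Adj x y → f x ≠ f y := by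
    intro C
    by_cases h : ∃ v ∈ X, C = comp v
    · obtain ⟨v, hv, rfl⟩ := h
      obtain ⟨f, hf⟩ := hcol v hv
      exact ⟨f, fun _ => hf⟩
    · exact ⟨fun _ => 0, fun h' => absurd h' h⟩
  choose F hF using hcol'
  have hself : ∀ v ∈ X, v ∈ comp v := fun v hv => ⟨hv, Relation.ReflTransGen.refl⟩
  refine hX ⟨fun v => F (comp v) v, ?_, ?_⟩
  · intro x hx
    exact (hF (comp x) ⟨x, hx, rfl⟩).1 x (hself x hx)
  · intro x hx y hy hxy
    have hsub : comp x = comp y := by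
      have h1 : G.ReachIn X x y := Relation.ReflTransGen.single ⟨hxy, hy⟩
      have h2 : G.ReachIn X y x := Relation.ReflTransGen.single ⟨hxy.symm, hx⟩
      ext w
      exact ⟨fun h => ⟨h.1, h2.trans h.2⟩, fun h => ⟨h.1, h1.trans h.2⟩⟩
    dsimp only
    rw [← hsub]
    exact (hF (comp x) ⟨x, hx, rfl⟩).2 x (hself x hx) y (hsub ▸ hself y hy) hxy

/-- Removing a set with few colours that meets a connected set leaves a component with many
colours that is attached to the removed set. -/
theorem exists_component_diff {n m : ℕ} {X Y : Set V} (hX : G.ConnOn X)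
    (hcol : ¬ G.ColOn (n + m) X) (hY : G.ColOn m Y) {v : V} (hvX : v ∈ X) (hvY : v ∈ Y) :
    ∃ C ⊆ X \ Y, G.ConnOn C ∧ ¬ G.ColOn n C ∧ ∃ b ∈ X ∩ Y, ∃ x ∈ C, G.Adj b x := by
  obtain ⟨C, hC, hconn, hcolC, hcl⟩ := exists_component_not_colOn (not_colOn_diff hcol hY)
  obtain ⟨x, hx⟩ := nonempty_of_not_colOn hcolC
  obtain ⟨a, ha, b, hb, hbC, hab⟩ := (hX x (hC hx).1 v hvX).exists_exit hx
    (fun h => (hC h).2 hvY)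
  refine ⟨C, hC, hconn, hcolC, b, ⟨hb, ?_⟩, a, ha, hab.symm⟩
  by_contra hbY
  exact hbC (hcl a ha b ⟨hb, hbY⟩ hab)

/-- In a set with many colours there is an edge `u v` and a connected set with many colours
containing `v` on which `ℓ` is at least `ℓ v ≥ ℓ u`. -/
theorem exists_active_edge {n : ℕ} {F : Set V} (ℓ : V → ℕ) (hF : ¬ G.ColOn (n + 1) F) :
    ∃ u ∈ F, ∃ v ∈ F, ∃ X ⊆ F, G.Adj u v ∧ G.ConnOn X ∧ v ∈ X ∧ ¬ G.ColOn n X ∧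
      ℓ u ≤ ℓ v ∧ ∀ x ∈ X, ℓ v ≤ ℓ x := by
  let A : Set V := {v | ∃ X ⊆ F, G.ConnOn X ∧ v ∈ X ∧ ¬ G.ColOn n X ∧ ∀ x ∈ X, ℓ v ≤ ℓ x}
  -- A component of `F \ A` needing more than `n` colours would witness that its vertex of least `ℓ`
  -- lies in `A`. Hence `A` is not stable, and the end of an edge of `A` with the larger `ℓ` serves
  -- as `v`.
  have hcol : G.ColOn n (F \ A) := by
    by_contra h
    obtain ⟨C, hC, hconn, hcolC, -⟩ := exists_component_not_colOn h
    obtain ⟨x, hx⟩ := nonempty_of_not_colOn hcolC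
    obtain ⟨v, hv, hmin⟩ := exists_minimalFor_of_wellFoundedLT (fun v => v ∈ C) ℓ ⟨x, hx⟩
    refine (hC hv).2 ⟨C, fun y hy => (hC hy).1, hconn, hv, hcolC, fun y hy => ?_⟩
    rcases le_total (ℓ v) (ℓ y) with h | h
    · exact h
    · exact hmin hy h
  have hA : ¬ G.ColOn 1 A := fun h => hF ((hcol.union h).mono (by simp) le_rfl)
  obtain ⟨u, hu, v, hv, huv⟩ := exists_adj_of_not_colOn_one hA
  have memF : ∀ v ∈ A, v ∈ F := fun v ⟨X, hX, _, hv, _⟩ => hX hv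
  rcases le_total (ℓ u) (ℓ v) with h | h
  · obtain ⟨X, hX, hc, hvX, hn, hl⟩ := hv
    exact ⟨u, memF u hu, v, hX hvX, X, hX, huv, hc, hvX, hn, h, hl⟩
  · obtain ⟨X, hX, hc, huX, hn, hl⟩ := hu
    exact ⟨v, memF v hv, u, hX huX, X, hX, huv.symm, hc, huX, hn, h, hl⟩

/-! ### Level functions and induced paths -/

/-- `f` behaves on `E` like the distance from `c` in the subgraph induced on `E`. -/
structure IsLevel (G : SimpleGraph V) (c : V) (E : Set V) (f : V → ℕ) : Prop where
  eq_of_zero : ∀ x ∈ E, f x = 0 → x = c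
  zero : f c = 0
  pred : ∀ x ∈ E, ∀ a, f x = a + 1 → ∃ y ∈ E, G.Adj y x ∧ f y = a
  lip : ∀ x ∈ E, ∀ y ∈ E, G.Adj x y → f x ≤ f y + 1

theorem Connected.isLevel_dist (hG : G.Connected) (c : V) : G.IsLevel c Set.univ (G.dist c) where
  eq_of_zero x _ h := (hG.dist_eq_zero_iff.1 h).symm
  zero := dist_self
  pred x _ a h := by
    obtain ⟨w, hw⟩ := hG.exists_walk_length_eq_dist c x
    have hl : w.length = a + 1 := by omega
    have hadj := w.adj_getVert_succ (i := a) (by omega)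
    rw [← hl, w.getVert_length] at hadj
    refine ⟨w.getVert a, trivial, hadj, le_antisymm ?_ ?_⟩
    · have := dist_le (w.take a)
      rw [Walk.take_length] at this
      omega
    · have h1 := hG.dist_triangle (u := c) (v := w.getVert a) (w := x)
      have h2 := dist_eq_one_iff_adj.2 hadj
      omega
  lip x _ y _ h := by
    have h1 := hG.dist_triangle (u := c) (v := y) (w := x)
    have h2 := dist_eq_one_iff_adj.2 h.symm
    omega

/-- Walks of length `n` from `x` whose later vertices lie in `X`. -/
def StepsIn (G : SimpleGraph V) (X : Set V) (x : V) : ℕ → V → Prop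
  | 0, y => x = y
  | n + 1, y => ∃ z, StepsIn G X x n z ∧ G.Adj z y ∧ y ∈ X

theorem ReachIn.exists_stepsIn {X : Set V} {x y : V} (h : G.ReachIn X x y) :
    ∃ n, G.StepsIn X x n y := by
  induction h with
  | refl => exact ⟨0, rfl⟩
  | tail _ h ih =>
    obtain ⟨n, hn⟩ := ih
    exact ⟨n + 1, _, hn, h⟩

theorem ConnOn.exists_isLevel {E : Set V} (hE : G.ConnOn E) {c : V} (hc : c ∈ E) :
    ∃ f, G.IsLevel c E f := by
  classical
  -- The default 0 is harmless: only values on `E` enter `IsLevel`.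
  let f : V → ℕ := fun x => if h : ∃ n, G.StepsIn E c n x then Nat.find h else 0
  have hex : ∀ x ∈ E, ∃ n, G.StepsIn E c n x := fun x hx => (hE c hc x hx).exists_stepsIn
  have hf : ∀ x ∈ E, G.StepsIn E c (f x) x := fun x hx => by
    simp only [f, dif_pos (hex x hx)]; exact Nat.find_spec (hex x hx)
  have hle : ∀ x ∈ E, ∀ n, G.StepsIn E c n x → f x ≤ n := fun x hx n hn => by
    simp only [f, dif_pos (hex x hx)]; exact Nat.find_min' _ hn
  have hmem : ∀ n y, G.StepsIn E c n y → y ∈ E := by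
    intro n y h
    cases n with
    | zero => exact (show c = y from h) ▸ hc
    | succ n => obtain ⟨z, _, _, hy⟩ := h; exact hy
  refine ⟨f, ?_, ?_, ?_, ?_⟩
  · intro x hx h
    have := hf x hx
    rw [h] at this
    exact (show c = x from this).symm
  · exact Nat.le_zero.1 (hle c hc 0 rfl)
  · intro x hx a h
    have := hf x hx
    rw [h] at this
    obtain ⟨z, hz, hzx, _⟩ := this
    have hzE := hmem _ _ hz
    refine ⟨z, hzE, hzx, le_antisymm (hle z hzE a hz) ?_⟩
    have := hle x hx (f z + 1) ⟨z, hf z hzE, hzx, hx⟩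
    omega
  · intro x hx y hy hxy
    exact hle x hx (f y + 1) ⟨y, hf y hy, hxy.symm, hx⟩

/-- The vertices `o 0, …, o n` form an induced path, in this order. -/
structure IsInducedPath (G : SimpleGraph V) (o : ℕ → V) (n : ℕ) : Prop where
  ne : ∀ i j, i < j → j ≤ n → o i ≠ o j
  adj_iff : ∀ i j, i < j → j ≤ n → (G.Adj (o i) (o j) ↔ j = i + 1)

theorem IsLevel.exists_path {c : V} {E : Set V} {f : V → ℕ} (hf : G.IsLevel c E f) {m : V}
    (hm : m ∈ E) : ∃ τ : ℕ → V, τ 0 = c ∧ τ (f m) = m ∧ (∀ i ≤ f m, τ i ∈ E ∧ f (τ i) = i) ∧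
      ∀ i < f m, G.Adj (τ i) (τ (i + 1)) := by
  generalize hn : f m = n
  induction n generalizing m with
  | zero =>
    refine ⟨fun _ => m, hf.eq_of_zero m hm hn, rfl, ?_, by omega⟩
    intro i hi
    exact ⟨hm, by dsimp only; omega⟩
  | succ n ih =>
    obtain ⟨y, hy, hym, hfy⟩ := hf.pred m hm n hn
    obtain ⟨τ, h0, h1, h2, h3⟩ := ih hy hfy
    refine ⟨fun i => if i ≤ n then τ i else m, by simp [h0], by simp, ?_, ?_⟩
    · intro i hi
      dsimp only
      split_ifs with h
      · exact h2 i h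
      · exact ⟨hm, by omega⟩
    · intro i hi
      dsimp only
      rw [if_pos (by omega : i ≤ n)]
      split_ifs with h
      · exact h3 i (by omega)
      · rw [show i = n by omega, h1]; exact hym

theorem IsLevel.isInducedPath {c : V} {E : Set V} {f : V → ℕ} (hf : G.IsLevel c E f)
    {τ : ℕ → V} {n : ℕ} (h1 : ∀ i ≤ n, τ i ∈ E ∧ f (τ i) = i)
    (h2 : ∀ i < n, G.Adj (τ i) (τ (i + 1))) : G.IsInducedPath τ n where
  ne i j hij hj h := by
    have a := (h1 i (by omega)).2
    have b := (h1 j hj).2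
    rw [h] at a
    omega
  adj_iff i j hij hj := by
    constructor
    · intro h
      have a := h1 i (by omega)
      have b := h1 j hj
      have := hf.lip _ b.1 _ a.1 h.symm
      omega
    · rintro rfl
      exact h2 i (by omega)

theorem ConnOn.exists_inducedPath {J : Set V} (hJ : G.ConnOn J) {c b : V} (hc : c ∈ J)
    (hb : b ∈ J) : ∃ (n : ℕ) (τ : ℕ → V), G.IsInducedPath τ n ∧ τ 0 = c ∧ τ n = b ∧
      ∀ i ≤ n, τ i ∈ J := by
  obtain ⟨f, hf⟩ := hJ.exists_isLevel hc
  obtain ⟨τ, h0, h1, h2, h3⟩ := hf.exists_path hb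
  exact ⟨f b, τ, hf.isInducedPath h2 h3, h0, h1, fun i hi => (h2 i hi).1⟩

theorem IsInducedPath.even_of_coloring {J : Set V} {τ : ℕ → V} {n : ℕ} (hτ : G.IsInducedPath τ n)
    (hJ : ∀ i ≤ n, τ i ∈ J) {κ : V → ℕ} (hκ : ∀ x ∈ J, ∀ y ∈ J, G.Adj x y → Odd (κ x + κ y)) :
    Even (n + κ (τ 0) + κ (τ n)) := by
  have key : ∀ i ≤ n, Even (i + κ (τ 0) + κ (τ i)) := by
    intro i hi
    induction i with
    | zero => simp
    | succ i ih =>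
      have h1 := ih (by omega)
      have h2 := hκ _ (hJ i (by omega)) _ (hJ (i + 1) hi)
        ((hτ.adj_iff i (i + 1) (by omega) hi).2 rfl)
      grind
  exact key n le_rfl

theorem IsInducedPath.append {o τ : ℕ → V} {n m : ℕ} (ho : G.IsInducedPath o n)
    (hτ : G.IsInducedPath τ m) (h0 : o n = τ 0)
    (hc : ∀ i < n, ∀ j, 1 ≤ j → j ≤ m → o i ≠ τ j ∧ ¬ G.Adj (o i) (τ j)) :
    G.IsInducedPath (fun k => if k ≤ n then o k else τ (k - n)) (n + m) where
  ne i j hij hj := by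
    split_ifs with h1 h2 h2
    · exact ho.ne i j hij h2
    · rcases Nat.lt_or_ge i n with h | h
      · exact (hc i h (j - n) (by omega) (by omega)).1
      · rw [show i = n by omega, h0]; exact hτ.ne _ _ (by omega) (by omega)
    · omega
    · exact hτ.ne _ _ (by omega) (by omega)
  adj_iff i j hij hj := by
    split_ifs with h1 h2 h2
    · exact ho.adj_iff i j hij h2
    · rcases Nat.lt_or_ge i n with h | h
      · have := (hc i h (j - n) (by omega) (by omega)).2
        exact ⟨fun h => absurd h this, fun h => by omega⟩
      · rw [show i = n by omega, h0, hτ.adj_iff _ _ (by omega) (by omega)]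
        omega
    · omega
    · rw [hτ.adj_iff _ _ (by omega) (by omega)]
      omega

theorem IsInducedPath.close {o ζ : ℕ → V} {n m : ℕ} (ho : G.IsInducedPath o n)
    (hζ : G.IsInducedPath ζ m) (h0 : o n = ζ 0) (h1 : ζ m = o 0) (hn : 1 ≤ n) (hm : 2 ≤ m)
    (hc : ∀ i, 0 < i → i < n → ∀ j, 0 < j → j < m → o i ≠ ζ j ∧ ¬ G.Adj (o i) (ζ j)) :
    G.IsInducedCycle (fun k => if k ≤ n then o k else ζ (k - n)) (n + m) where
  ne i j hij hj := by
    split_ifs with h2 h3 h3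
    · exact ho.ne i j hij h3
    · rcases Nat.lt_or_ge i n with h | h
      · rcases Nat.eq_zero_or_pos i with h' | h'
        · rw [h', ← h1]; exact (hζ.ne _ _ (by omega) (by omega)).symm
        · exact (hc i h' h (j - n) (by omega) (by omega)).1
      · rw [show i = n by omega, h0]; exact hζ.ne _ _ (by omega) (by omega)
    · omega
    · exact hζ.ne _ _ (by omega) (by omega)
  adj_iff i j hij hj := by
    split_ifs with h2 h3 h3
    · rw [ho.adj_iff i j hij h3]; omega
    · rcases Nat.lt_or_ge i n with h | h
      · rcases Nat.eq_zero_or_pos i with h' | h'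
        · rw [h', ← h1, G.adj_comm, hζ.adj_iff _ _ (by omega) (by omega)]; omega
        · have := (hc i h' h (j - n) (by omega) (by omega)).2
          exact ⟨fun h => absurd h this, fun h => by omega⟩
      · rw [show i = n by omega, h0, hζ.adj_iff _ _ (by omega) (by omega)]
        omega
    · omega
    · rw [hζ.adj_iff _ _ (by omega) (by omega)]
      omega

theorem Connected.dist_le_of_seq (hG : G.Connected) {τ : ℕ → V} {n : ℕ}
    (h : ∀ i < n, G.Adj (τ i) (τ (i + 1))) {i j : ℕ} (hij : i ≤ j) (hj : j ≤ n) :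
    G.dist (τ i) (τ j) ≤ j - i := by
  induction j, hij using Nat.le_induction with
  | base => simp
  | succ j hij ih =>
    have h1 := ih (by omega)
    have h2 := hG.dist_triangle (u := τ i) (v := τ j) (w := τ (j + 1))
    have h3 := dist_eq_one_iff_adj.2 (h j (by omega))
    omega

theorem Connected.exists_geodesic (hG : G.Connected) (x y : V) :
    ∃ τ : ℕ → V, τ 0 = x ∧ τ (G.dist x y) = y ∧ (∀ i ≤ G.dist x y, G.dist x (τ i) = i) ∧
      (∀ i ≤ G.dist x y, G.dist y (τ i) ≤ G.dist x y - i) ∧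
      ∀ i < G.dist x y, G.Adj (τ i) (τ (i + 1)) := by
  obtain ⟨τ, h0, h1, h2, h3⟩ := (hG.isLevel_dist x).exists_path (Set.mem_univ y)
  refine ⟨τ, h0, h1, fun i hi => (h2 i hi).2, fun i hi => ?_, h3⟩
  have := hG.dist_le_of_seq h3 hi le_rfl
  rwa [h1, dist_comm] at this

/-! ### Ropes with segments of either parity -/

/-- A segment of the rope: from `c` down the levels of `E`, then along shortest paths to `y`, the
vertex `v` next to `y`, and `b`. The parity of its length is prescribed. -/
theorem exists_segment (hG : G.Connected)
    (hball : ∀ v x y, G.dist v x ≤ 100 → G.Adj x y → G.dist v x ≠ G.dist v y)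
    {c : V} {E : Set V} {f : V → ℕ} (hf : G.IsLevel c E f) {ρ R ℓ : ℕ} (hρR : ρ + 2 ≤ R)
    (hRρ : R + 2 ≤ 2 * ρ) (hR : R ≤ 100) {y v b m : V} (hyv : y = v ∨ G.Adj y v) (hm : m ∈ E)
    (hfm : f m = ℓ) (hym : G.dist y m = ρ)
    (hy : ∀ m' ∈ E, G.dist y m' ≤ ρ → ℓ ≤ f m') (hv : ∀ m' ∈ E, G.dist v m' ≤ ρ → ℓ ≤ f m')
    (hb : ∀ m' ∈ E, G.dist b m' ≤ ρ → ℓ ≤ f m') (hvb : G.dist v b = R) (hvc : R < G.dist v c) :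
    ∃ (n : ℕ) (τ : ℕ → V), G.IsInducedPath τ n ∧ τ 0 = c ∧ τ n = b ∧
      Even (n + ℓ + ρ + G.dist y v + R) ∧
      ∀ i ≤ n, (τ i ∈ E ∧ f (τ i) < ℓ) ∨ ((G.dist v (τ i) < R ∨ τ i = b) ∧
        (G.dist y (τ i) ≤ ρ ∨ G.dist v (τ i) ≤ ρ ∨ G.dist b (τ i) ≤ ρ)) := by
  classical
  obtain ⟨t, t0, t1, t2, t3⟩ := hf.exists_path hm
  rw [hfm] at t1 t2 t3
  obtain ⟨g, g0, g1, g2, -, g4⟩ := hG.exists_geodesic y m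
  rw [hym] at g1 g2 g4
  obtain ⟨s, s0, s1, s2, s3, s4⟩ := hG.exists_geodesic v b
  rw [hvb] at s1 s2 s3 s4
  have hvy : G.dist v y ≤ 1 := by
    rcases hyv with h | h
    · subst h; simp
    · rw [dist_eq_one_iff_adj.2 h.symm]
  let T : Set V := {x | ∃ i ≤ ℓ, x = t i}
  let Gs : Set V := {x | ∃ i ≤ ρ, x = g i}
  let Ss : Set V := {x | ∃ i ≤ R, x = s i}
  let Loc : Set V := insert v Gs ∪ Ss
  have hyG : y ∈ Gs := ⟨0, by omega, g0.symm⟩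
  have hmG : m ∈ Gs := ⟨ρ, le_rfl, g1.symm⟩
  have hmL : m ∈ Loc := Or.inl (Or.inr hmG)
  have hbL : b ∈ Loc := Or.inr ⟨R, le_rfl, s1.symm⟩
  have hvS : v ∈ Ss := ⟨0, by omega, s0.symm⟩
  have hmT : m ∈ T := ⟨ℓ, le_rfl, t1.symm⟩
  have hconnL : G.ConnOn Loc := by
    refine ConnOn.union ?_ (connOn_range s4) (Set.mem_insert _ _) hvS
    rcases hyv with h | h
    · rw [Set.insert_eq_of_mem (h ▸ hyG)]; exact connOn_range g4
    · exact (connOn_range g4).insert_of_adj hyG h.symm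
  have hconn : G.ConnOn (T ∪ Loc) := (connOn_range t3).union hconnL hmT hmL
  have tri := fun a b d => hG.dist_triangle (u := a) (v := b) (w := d)
  have L1 : ∀ x ∈ Loc, G.dist v x < R ∨ x = b := by
    rintro x ((rfl | ⟨i, hi, rfl⟩) | ⟨i, hi, rfl⟩)
    · left; simp; omega
    · left
      have := tri v y (g i)
      have := g2 i hi
      omega
    · rcases hi.lt_or_eq with h | h
      · left; rw [s2 i hi]; exact h
      · right; rw [h, s1]
  -- The path from `v` to `b` has length `R ≤ 2 * ρ - 2`, so the `ρ`-balls about its ends cover it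
  -- with room to spare.
  have L2 : ∀ x ∈ Loc, G.dist y x ≤ ρ ∨ G.dist v x ≤ ρ ∨ G.dist b x ≤ ρ := by
    rintro x ((rfl | ⟨i, hi, rfl⟩) | ⟨i, hi, rfl⟩)
    · right; left; simp
    · left; rw [g2 i hi]; exact hi
    · right
      have := s2 i hi
      have := s3 i hi
      omega
  -- Every vertex of `Loc` except `m` is within `ρ - 1` of `y`, `v` or `b`; its neighbours are
  -- within `ρ`, where `E` has no level below `ℓ`.
  have L3 : ∀ x ∈ Loc, x ≠ m → ∀ m' ∈ E, f m' < ℓ → ¬ G.Adj x m' := by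
    intro x hx hxm m' hm' hlt hadj
    have h1 := dist_eq_one_iff_adj.2 hadj
    rcases hx with (rfl | ⟨i, hi, rfl⟩) | ⟨i, hi, rfl⟩
    · have := hv m' hm' (by omega)
      omega
    · have hi' : i ≠ ρ := fun h => hxm (by rw [h, g1])
      have h2 := g2 i hi
      have h3 := tri y (g i) m'
      have := hy m' hm' (by omega)
      omega
    · have h2 := s2 i hi
      have h3 := s3 i hi
      have h4 := tri v (s i) m'
      have h5 := tri b (s i) m'
      rcases Nat.lt_or_ge i ρ with h | h
      · have := hv m' hm' (by omega)
        omega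
      · have := hb m' hm' (by omega)
        omega
  have hLR : ∀ x ∈ Loc, G.dist v x ≤ R := by
    intro x hx
    rcases L1 x hx with h | h
    · exact h.le
    · rw [h, hvb]
  have hcL : c ∉ Loc := fun h => by have := hLR c h; omega
  have hpar : Even (G.dist v m + ρ + G.dist y v) := by
    rcases hyv with h | h
    · subst h; rw [hym]; simp
    · have h1 := hball m y v (by rw [dist_comm, hym]; omega) h
      have h2 := tri m y v
      have h3 := tri m v y
      have h4 := dist_eq_one_iff_adj.2 h
      have h5 := dist_eq_one_iff_adj.2 h.symm
      rw [dist_comm (u := m) (v := y), hym] at h1 h2 h3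
      rw [dist_comm (u := m) (v := v)] at h1 h2 h3
      rw [Nat.even_iff]
      omega
  -- A proper 2-colouring of `T ∪ Loc`: distance from `v` on `Loc`, level on `T`, shifted so that
  -- the two fit at `m`, the only contact. It fixes the length parity of any induced path from `c`
  -- to `b`, so a shortest one can be taken.
  let κ : V → ℕ := fun x => if x ∈ Loc then G.dist v x else f x + ℓ + ρ + G.dist y v
  have hκ : ∀ x ∈ T ∪ Loc, ∀ x' ∈ T ∪ Loc, G.Adj x x' → Odd (κ x + κ x') := by
    have mixed : ∀ x ∈ Loc, ∀ x' ∈ T, x' ∉ Loc → G.Adj x x' →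
        Odd (G.dist v x + (f x' + ℓ + ρ + G.dist y v)) := by
      rintro x hx x' ⟨j, hj, rfl⟩ hx' hadj
      have hjl : j ≠ ℓ := fun h => hx' (by rw [h, t1]; exact hmL)
      have ht := t2 j hj
      have hxm : x = m := by
        by_contra h
        exact L3 x hx h (t j) ht.1 (by omega) hadj
      subst hxm
      have := hf.lip x hm (t j) ht.1 hadj
      rw [Nat.even_iff] at hpar
      rw [Nat.odd_iff]
      omega
    intro x hx x' hx' hadj
    simp only [κ]
    by_cases h : x ∈ Loc <;> by_cases h' : x' ∈ Loc
    · rw [if_pos h, if_pos h']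
      have h1 := hball v x x' ((hLR x h).trans hR) hadj
      have h2 := tri v x x'
      have h3 := tri v x' x
      have h4 := dist_eq_one_iff_adj.2 hadj
      have h5 := dist_eq_one_iff_adj.2 hadj.symm
      rw [Nat.odd_iff]
      omega
    · rw [if_pos h, if_neg h']
      exact mixed x h x' (hx'.resolve_right h') h' hadj
    · rw [if_neg h, if_pos h', add_comm]
      exact mixed x' h' x (hx.resolve_right h) h hadj.symm
    · rw [if_neg h, if_neg h']
      obtain ⟨i, hi, rfl⟩ := hx.resolve_right h
      obtain ⟨j, hj, rfl⟩ := hx'.resolve_right h'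
      have a := t2 i hi
      have b := t2 j hj
      have h1 := hf.lip _ a.1 _ b.1 hadj
      have h2 := hf.lip _ b.1 _ a.1 hadj.symm
      have : i ≠ j := fun h => hadj.ne (by rw [h])
      rw [Nat.odd_iff]
      omega
  obtain ⟨n, τ, hτ, τ0, τn, hτJ⟩ := hconn.exists_inducedPath
    (c := c) (b := b) (Or.inl ⟨0, Nat.zero_le _, t0.symm⟩) (Or.inr hbL)
  refine ⟨n, τ, hτ, τ0, τn, ?_, ?_⟩
  · have := hτ.even_of_coloring hτJ hκ
    rw [τ0, τn] at this
    simp only [κ, if_neg hcL, if_pos hbL, hvb, hf.zero] at this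
    rw [Nat.even_iff] at this ⊢
    omega
  · intro i hi
    by_cases h : τ i ∈ Loc
    · exact Or.inr ⟨L1 _ h, L2 _ h⟩
    · obtain ⟨j, hj, hje⟩ := (hτJ i hi).resolve_right h
      have hjl : j ≠ ℓ := fun h' => h (by rw [hje, h', t1]; exact hmL)
      have := t2 j hj
      rw [hje]
      exact Or.inl ⟨this.1, by omega⟩

/-- A rope with `i` flexible segments and joints `c 0, …, c i`, drawn inside `P`, together with a
connected set `E` attached to its end into which the rope can be continued. -/
structure RopeState (G : SimpleGraph V) (δ : V → V → ℕ) (A₀ : Set V) (i : ℕ) (c : ℕ → V)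
    (E P : Set V) : Prop where
  conn : G.ConnOn E
  subset : E ⊆ A₀
  attached : ∃ x ∈ E, G.Adj (c i) x
  notMem : c i ∉ E
  clean : ∀ x ∈ E, ∀ y ∈ P, y ≠ c i → x ≠ y ∧ ¬ G.Adj x y
  -- Points added near a joint are within 14 of a vertex at distance 14 from it, hence the 28. The
  -- margin `13 - i` shrinks by one per segment.
  thick : ∀ y ∈ P, y = c 0 ∨ (∃ j, 1 ≤ j ∧ j ≤ i ∧ G.dist (c j) y ≤ 28) ∨
    (y ∈ A₀ ∧ ∀ x ∈ E, 13 - i < G.dist x y)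
  mem : ∀ j, 1 ≤ j → j ≤ i → c j ∈ A₀
  far : ∀ j j', j < j' → j' ≤ i → 86 < δ (c j) (c j')
  -- `σ j` prescribes the parity of the `j`-th segment, while `P` contains the rope for every choice
  -- of parities.
  flex : ∀ σ : ℕ → ℕ, ∃ (o : ℕ → V) (p : ℕ → ℕ), G.IsInducedPath o (p i) ∧
    (∀ k ≤ p i, o k ∈ P) ∧ p 0 = 0 ∧ (∀ j ≤ i, o (p j) = c j) ∧
    ∀ j < i, p j < p (j + 1) ∧ Even (p (j + 1) + p j + σ j)

theorem colOn_iUnion_balls {δ : V → V → ℕ} (hδ : ∀ c, G.ColOn 2 {x | δ c x ≤ 100})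
    (c : ℕ → V) (i : ℕ) : G.ColOn (2 * (i + 1)) {x | ∃ j ≤ i, δ (c j) x ≤ 100} := by
  induction i with
  | zero => exact (hδ (c 0)).mono (fun x ⟨j, hj, h⟩ => by
      rw [Nat.le_zero.1 hj] at h; exact h) (by omega)
  | succ i ih =>
    refine (ih.union (hδ (c (i + 1)))).mono ?_ (by omega)
    rintro x ⟨j, hj, h⟩
    rcases hj.lt_or_eq with h' | h'
    · exact Or.inl ⟨j, by omega, h⟩
    · rw [h'] at h; exact Or.inr h

/-- Let `ℓ x` be the lowest level, seen from `c i`, met by the `ρ`-ball about `x`. For an edge `u v`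
with `ℓ u`, `ℓ v` of equal parity, descending from `u` or from `v` gives segments whose lengths have
opposite parity. Since `ℓ ≥ ℓ v` on `X`, the levels below `ℓ v` stay away from `X`, and the rope can
continue in a component of `X` outside the 14-ball about `v`. The colour count is `4 * n + 32 = 2 *
(2 * (n + 3) + 10)`: two halvings, 10 for the balls about the joints, 1 for the active edge and 2
for the ball about `v`. -/
theorem RopeState.step (hG : G.Connected)
    (hball : ∀ v x y, G.dist v x ≤ 100 → G.Adj x y → G.dist v x ≠ G.dist v y)
    {δ : V → V → ℕ} (hδ1 : ∀ x y, δ x y ≤ G.dist x y)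
    (hδ2 : ∀ x y z, δ x z ≤ δ x y + G.dist y z)
    (hδ : ∀ c, G.ColOn 2 {x | δ c x ≤ 100})
    {A₀ : Set V} {i : ℕ} {c : ℕ → V} {E P : Set V} (hS : G.RopeState δ A₀ i c E P) (hi : i ≤ 4)
    {n : ℕ} (hcol : ¬ G.ColOn (4 * n + 32) E) :
    ∃ (c' : ℕ → V) (E' P' : Set V), G.RopeState δ A₀ (i + 1) c' E' P' ∧ ¬ G.ColOn n E' ∧
      c' 0 = c 0 := by
  classical
  have tri := fun a b d => hG.dist_triangle (u := a) (v := b) (w := d)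
  obtain ⟨x₀, hx₀, hcx₀⟩ := hS.attached
  set E₁ : Set V := insert (c i) E with hE₁
  have hEE₁ : E ⊆ E₁ := Set.subset_insert _ _
  obtain ⟨f, hf⟩ := (hS.conn.insert_of_adj hx₀ hcx₀).exists_isLevel (Set.mem_insert _ _)
  obtain ⟨k, hk⟩ := exists_fibre_not_colOn (n := 2 * (n + 3) + 10) (X := E) (f := f)
    (fun x hx y hy => hf.lip x (hEE₁ hx) y (hEE₁ hy))
    (fun h => hcol (h.mono subset_rfl (by omega)))
  have hk' := not_colOn_diff hk ((colOn_iUnion_balls hδ c i).mono subset_rfl (by omega : _ ≤ 10))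
  -- For `i ≤ 4` this satisfies `ρ + 2 ≤ 14` and `14 + 2 ≤ 2 * ρ`. Also `ρ + 1 = 13 - i` is the old
  -- margin, so what lies within `ρ` of `E` is not adjacent to old rope vertices guarded by it, and
  -- `ρ` is the next margin.
  set ρ := 12 - i with hρ
  let ℓ : V → ℕ := fun x => sInf {a | ∃ m ∈ E₁, f m = a ∧ G.dist x m ≤ ρ}
  have hℓmin : ∀ x, ∀ m ∈ E₁, G.dist x m ≤ ρ → ℓ x ≤ f m := fun x m hm h =>
    Nat.sInf_le ⟨m, hm, rfl, h⟩
  have hℓmem : ∀ x ∈ E₁, ∃ m ∈ E₁, f m = ℓ x ∧ G.dist x m ≤ ρ := fun x hx =>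
    Nat.sInf_mem (s := {a | ∃ m ∈ E₁, f m = a ∧ G.dist x m ≤ ρ}) ⟨f x, x, hx, rfl, by simp⟩
  obtain ⟨π, hπ⟩ := exists_parity_not_colOn ℓ hk'
  obtain ⟨u, hu, v, hv, X, hXF, huv, hXconn, hvX, hXcol, huvl, hXl⟩ :=
    exists_active_edge (n := n + 2) ℓ hπ
  have hFE : ∀ x, x ∈ X ∨ x = u → x ∈ E ∧ (∀ j ≤ i, 100 < δ (c j) x) ∧ ℓ x % 2 = π := by
    intro x hx
    have : x ∈ {x | x ∈ {x | x ∈ E ∧ f x = k} \ {x | ∃ j ≤ i, δ (c j) x ≤ 100} ∧ ℓ x % 2 = π} := by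
      rcases hx with h | h
      · exact hXF h
      · rw [h]; exact hu
    refine ⟨this.1.1.1, fun j hj => ?_, this.2⟩
    by_contra h
    exact this.1.2 ⟨j, hj, by omega⟩
  have hexact : ∀ x, x ∈ X ∨ x = u → ∃ m ∈ E₁, f m = ℓ x ∧ G.dist x m = ρ := by
    intro x hx
    obtain ⟨hxE, hxfar, -⟩ := hFE x hx
    obtain ⟨m, hm, hfm, hd⟩ := hℓmem x (hEE₁ hxE)
    refine ⟨m, hm, hfm, le_antisymm hd ?_⟩
    by_contra hlt
    rcases Nat.eq_zero_or_pos (f m) with h0 | h0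
    · have := hf.eq_of_zero m hm h0
      have h1 := hxfar i le_rfl
      have h2 := hδ1 (c i) x
      rw [this, dist_comm] at hd
      omega
    · obtain ⟨m', hm', hadj, hfm'⟩ := hf.pred m hm (f m - 1) (by omega)
      have h1 := dist_eq_one_iff_adj.2 hadj.symm
      have h2 := tri x m m'
      have h3 := hℓmin x m' hm' (by omega)
      omega
  obtain ⟨C, hCX, hCconn, hCcol, b, hb, xb, hxb, hbxb⟩ := exists_component_diff (n := n) (m := 2)
    (Y := {x | G.dist v x ≤ 14}) hXconn hXcol
    ((hδ v).mono (fun x hx => (hδ1 v x).trans ((show G.dist v x ≤ 14 from hx).trans (by omega)))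
      le_rfl) hvX (by simp)
  have hCd : ∀ x ∈ C, 14 < G.dist v x := fun x hx => by
    by_contra h; exact (hCX hx).2 (by simpa using h)
  have hvb : G.dist v b = 14 := by
    have h1 : G.dist v b ≤ 14 := hb.2
    have h2 := hCd xb hxb
    have h3 := tri v b xb
    have h4 := dist_eq_one_iff_adj.2 hbxb
    omega
  have hvfar := (hFE v (Or.inl hvX)).2.1
  have hvfar' : ∀ j ≤ i, 100 < G.dist (c j) v := fun j hj => (hvfar j hj).trans_le (hδ1 _ _)
  have hbX : b ∈ X := hb.1
  have hvci : 14 < G.dist v (c i) := by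
    rw [dist_comm]; have := hvfar' i le_rfl; omega
  obtain ⟨mv, hmv, hfmv, hdmv⟩ := hexact v (Or.inl hvX)
  obtain ⟨mu, hmu, hfmu, hdmu⟩ := hexact u (Or.inr rfl)
  obtain ⟨n₀, τ₀, hτ₀, τ₀0, τ₀n, hpar₀, hτ₀Q⟩ := exists_segment hG hball hf (ρ := ρ) (R := 14)
    (ℓ := ℓ v) (y := v) (v := v) (b := b) (by omega) (by omega) (by omega) (Or.inl rfl) hmv hfmv
    hdmv (hℓmin v) (hℓmin v) (fun m hm h => (hXl b hbX).trans (hℓmin b m hm h)) hvb hvci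
  obtain ⟨n₁, τ₁, hτ₁, τ₁0, τ₁n, hpar₁, hτ₁Q⟩ := exists_segment hG hball hf (ρ := ρ) (R := 14)
    (ℓ := ℓ u) (y := u) (v := v) (b := b) (by omega) (by omega) (by omega) (Or.inr huv) hmu hfmu
    hdmu (hℓmin u) (fun m hm h => huvl.trans (hℓmin v m hm h))
    (fun m hm h => huvl.trans ((hXl b hbX).trans (hℓmin b m hm h))) hvb hvci
  let Q : Set V := {x | (x ∈ E₁ ∧ f x < ℓ v) ∨ ((G.dist v x < 14 ∨ x = b) ∧
    (G.dist u x ≤ ρ ∨ G.dist v x ≤ ρ ∨ G.dist b x ≤ ρ))}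
  have hQ₀ : ∀ k ≤ n₀, τ₀ k ∈ Q := by
    intro k hk
    rcases hτ₀Q k hk with h | ⟨h, h'⟩
    · exact Or.inl h
    · exact Or.inr ⟨h, by tauto⟩
  have hQ₁ : ∀ k ≤ n₁, τ₁ k ∈ Q := by
    intro k hk
    rcases hτ₁Q k hk with h | h
    · exact Or.inl ⟨h.1, by omega⟩
    · exact Or.inr h
  have hCE : C ⊆ E := fun x hx => (hFE x (Or.inl (hCX hx).1)).1
  have hcib : c i ≠ b := by
    intro h; rw [← h] at hvb; omega
  -- the new segment meets the old rope only at the last joint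
  have hcontact : ∀ y ∈ P, y ≠ c i → ∀ q ∈ Q, q ≠ c i → y ≠ q ∧ ¬ G.Adj y q := by
    intro y hy hyc q hq hqc
    rcases hq with ⟨hqE, -⟩ | ⟨hq1, hq2⟩
    · have := hS.clean q (hqE.resolve_left hqc) y hy hyc
      exact ⟨this.1.symm, fun h => this.2 h.symm⟩
    · have hvq : G.dist v q ≤ 14 := by
        rcases hq1 with h | h
        · exact h.le
        · rw [h, hvb]
      have key : 1 < G.dist y q := by
        have hsy : G.dist q y = G.dist y q := dist_comm
        rcases hS.thick y hy with h | ⟨j, -, hj, h⟩ | ⟨-, h⟩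
        · subst h
          have h1 := hvfar' 0 (Nat.zero_le _)
          have h2 := tri (c 0) q v
          rw [dist_comm (u := q) (v := v)] at h2
          omega
        · have h1 := hvfar' j hj
          have h2 := tri (c j) y v
          have h3 := tri y q v
          rw [dist_comm (u := q) (v := v)] at h3
          omega
        · rcases hq2 with h' | h' | h'
          · have := h u (hFE u (Or.inr rfl)).1
            have := tri u q y
            omega
          · have := h v (hFE v (Or.inl hvX)).1
            have := tri v q y
            omega
          · have := h b (hFE b (Or.inl hbX)).1
            have := tri b q y
            omega
      constructor
      · rintro rfl; simp at key
      · intro h; rw [dist_eq_one_iff_adj.2 h] at key; omega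
  have hcu : ∀ j ≤ i, Function.update c (i + 1) b j = c j := fun j hj => by
    rw [Function.update_of_ne (by omega)]
  refine ⟨Function.update c (i + 1) b, C, P ∪ Q, ?_, hCcol, hcu 0 (Nat.zero_le _)⟩
  refine ⟨hCconn, hCE.trans hS.subset, ?_, ?_, ?_, ?_, ?_, ?_, ?_⟩
  · rw [Function.update_self]; exact ⟨xb, hxb, hbxb⟩
  · rw [Function.update_self]; intro h; have := hCd b h; omega
  · rw [Function.update_self]
    intro x hx y hy hyb
    have key : (y = c i ∨ y ∈ Q) → x ≠ y ∧ ¬ G.Adj x y := by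
      intro hy
      have : 1 < G.dist x y := by
        rcases hy with h | ⟨h, h'⟩ | ⟨h, -⟩
        · have h1 := (hFE x (Or.inl (hCX hx).1)).2.1 i le_rfl
          have h2 := hδ1 (c i) x
          rw [h, dist_comm]; omega
        · by_contra hcon
          have h1 := hℓmin x y h (by omega)
          have h2 := hXl x (hCX hx).1
          omega
        · have h1 := hCd x hx
          have h2 := h.resolve_right hyb
          have h3 := tri v y x
          rw [dist_comm (u := y) (v := x)] at h3
          omega
      constructor
      · rintro rfl; simp at this
      · intro h; rw [dist_eq_one_iff_adj.2 h] at this; omega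
    rcases hy with hy | hy
    · by_cases h : y = c i
      · exact key (Or.inl h)
      · exact hS.clean x (hCE hx) y hy h
    · exact key (Or.inr hy)
  · rw [hcu 0 (Nat.zero_le _)]
    rintro y (hy | hy)
    · rcases hS.thick y hy with h | ⟨j, h1, h2, h3⟩ | ⟨h1, h2⟩
      · exact Or.inl h
      · exact Or.inr (Or.inl ⟨j, h1, by omega, by rw [hcu j h2]; exact h3⟩)
      · exact Or.inr (Or.inr ⟨h1, fun x hx => by have := h2 x (hCE hx); omega⟩)
    · rcases hy with ⟨h, h'⟩ | ⟨h, -⟩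
      · rcases h with h | h
        · rcases Nat.eq_zero_or_pos i with h0 | h0
          · left; rw [h, h0]
          · exact Or.inr (Or.inl ⟨i, h0, by omega, by rw [hcu i le_rfl, h]; simp⟩)
        · refine Or.inr (Or.inr ⟨hS.subset h, fun x hx => ?_⟩)
          by_contra hcon
          have h1 := hℓmin x y (hEE₁ h) (by omega)
          have h2 := hXl x (hCX hx).1
          omega
      · refine Or.inr (Or.inl ⟨i + 1, by omega, le_rfl, ?_⟩)
        rw [Function.update_self]
        have h1 := tri b v y
        rw [dist_comm (u := b) (v := v)] at h1
        rcases h with h | h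
        · omega
        · rw [h]; simp
  · intro j h1 h2
    rcases h2.lt_or_eq with h | h
    · rw [hcu j (by omega)]; exact hS.mem j h1 (by omega)
    · rw [h, Function.update_self]; exact hS.subset (hFE b (Or.inl hbX)).1
  · intro j j' h1 h2
    rw [hcu j (by omega)]
    rcases h2.lt_or_eq with h | h
    · rw [hcu j' (by omega)]; exact hS.far j j' h1 (by omega)
    · rw [h, Function.update_self]
      have a := hvfar j (by omega)
      have a2 := hδ2 (c j) b v
      rw [dist_comm, hvb] at a2
      omega
  · intro σ
    obtain ⟨o, p, ho, hoP, p0, hop, hpσ⟩ := hS.flex σ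
    obtain ⟨m, τ, hτ, τ0, τm, hτQ, hm⟩ : ∃ (m : ℕ) (τ : ℕ → V), G.IsInducedPath τ m ∧ τ 0 = c i ∧
        τ m = b ∧ (∀ k ≤ m, τ k ∈ Q) ∧ Even (m + σ i) := by
      have e1 := (hFE v (Or.inl hvX)).2.2
      have e2 := (hFE u (Or.inr rfl)).2.2
      have e3 : G.dist u v = 1 := dist_eq_one_iff_adj.2 huv
      rw [dist_self, Nat.even_iff] at hpar₀
      rw [e3, Nat.even_iff] at hpar₁
      by_cases h : Even (n₀ + σ i)
      · exact ⟨n₀, τ₀, hτ₀, τ₀0, τ₀n, hQ₀, h⟩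
      · refine ⟨n₁, τ₁, hτ₁, τ₁0, τ₁n, hQ₁, ?_⟩
        rw [Nat.even_iff] at h ⊢
        omega
    have hmpos : 0 < m := by
      rcases Nat.eq_zero_or_pos m with h | h
      · rw [h, τ0] at τm; exact absurd τm hcib
      · exact h
    have hpi : o (p i) = c i := hop i le_rfl
    have hple : ∀ j ≤ i, p j ≤ p i := by
      intro j hj
      obtain ⟨d, rfl⟩ := Nat.exists_eq_add_of_le hj
      have : ∀ e ≤ d, p j ≤ p (j + e) := by
        intro e he
        induction e with
        | zero => exact le_rfl
        | succ e ih =>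
          have h1 := ih (by omega)
          have h2 := (hpσ (j + e) (by omega)).1
          rw [show j + (e + 1) = j + e + 1 by ring]
          omega
      exact this d le_rfl
    have happ := ho.append hτ (by rw [hpi, τ0]) (fun a ha j hj1 hj2 =>
      hcontact (o a) (hoP a ha.le) (by rw [← hpi]; exact ho.ne a _ ha le_rfl) (τ j)
        (hτQ j hj2) (by rw [← τ0]; exact (hτ.ne 0 j (by omega) hj2).symm))
    have hpu : ∀ j ≤ i, Function.update p (i + 1) (p i + m) j = p j := fun j hj => by
      rw [Function.update_of_ne (by omega)]
    refine ⟨fun k => if k ≤ p i then o k else τ (k - p i), Function.update p (i + 1) (p i + m),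
      ?_, ?_, ?_, ?_, ?_⟩
    · rw [Function.update_self]; exact happ
    · rw [Function.update_self]
      intro k hk
      dsimp only
      split_ifs with h
      · exact Or.inl (hoP k h)
      · exact Or.inr (hτQ _ (by omega))
    · rw [hpu 0 (Nat.zero_le _), p0]
    · intro j hj
      dsimp only
      rcases hj.lt_or_eq with h | h
      · rw [hpu j (by omega), hcu j (by omega), if_pos (hple j (by omega)), hop j (by omega)]
      · rw [h, Function.update_self, Function.update_self, if_neg (by omega)]
        rw [Nat.add_sub_cancel_left, τm]
    · intro j hj
      rcases (Nat.lt_succ_iff.1 hj).lt_or_eq with h | h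
      · rw [hpu (j + 1) (by omega), hpu j (by omega)]
        exact hpσ j h
      · rw [h, hpu i le_rfl, Function.update_self]
        refine ⟨by omega, ?_⟩
        rw [Nat.even_iff] at hm ⊢
        omega

/-! ### Closing the rope -/

/-- Prescribing the parities of the gaps between joints so that three chosen joints cut a cycle
into odd arcs. -/
theorem exists_parity_choice (m : ℕ) {a b d : ℕ} (ha : 1 ≤ a) (hab : a < b) (hbd : b < d)
    (hd : d ≤ 5) : ∃ σ : ℕ → ℕ, ∀ p : ℕ → ℕ, p 0 = 0 →
      (∀ j < 5, p j < p (j + 1) ∧ Even (p (j + 1) + p j + σ j)) →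
      Odd (p 5 + m) ∧ p a < p b ∧ p b < p d ∧ p d ≤ p 5 ∧ Odd (p b - p a) ∧ Odd (p d - p b) := by
  -- The segments starting at joints `a` and `b` are odd, the other ones after the first are even,
  -- and the first one corrects the parity of the whole cycle against the closing path of length
  -- `m`.
  refine ⟨fun j => if j = 0 then 1 + m else if j = a ∨ j = b then 1 else 0, fun p p0 hp => ?_⟩
  have mono : ∀ i j, i ≤ j → j ≤ 5 → p i + (j - i) ≤ p j := by
    intro i j hij hj
    induction j, hij using Nat.le_induction with
    | base => simp
    | succ j hij ih =>
      have h1 := ih (by omega)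
      have h2 := (hp j (by omega)).1
      omega
  have par : ∀ j, 1 ≤ j → j ≤ 5 →
      p j % 2 = (1 + m + (if a < j then 1 else 0) + (if b < j then 1 else 0)) % 2 := by
    intro j hj hj5
    induction j, hj using Nat.le_induction with
    | base =>
      have h2 := (hp 0 (by omega)).2
      rw [Nat.even_iff] at h2
      simp only [p0, if_true, zero_add] at h2
      rw [if_neg (by omega), if_neg (by omega)]
      omega
    | succ j hj ih =>
      have h1 := ih (by omega)
      have h2 := (hp j (by omega)).2
      rw [Nat.even_iff] at h2
      dsimp only at h2
      rw [if_neg (by omega)] at h2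
      split_ifs at h1 h2 ⊢ <;> omega
  have pa := par a ha (by omega)
  have pb := par b (by omega) (by omega)
  have pd := par d (by omega) hd
  have p5 := par 5 (by omega) le_rfl
  have m1 := mono a b (by omega) (by omega)
  have m2 := mono b d (by omega) (by omega)
  have m3 := mono d 5 hd le_rfl
  rw [if_neg (by omega), if_neg (by omega)] at pa
  rw [if_pos (by omega), if_neg (by omega)] at pb
  rw [if_pos (by omega), if_pos (by omega)] at pd
  rw [if_pos (by omega), if_pos (by omega)] at p5
  simp only [Nat.odd_iff]
  refine ⟨by omega, by omega, by omega, by omega, by omega, by omega⟩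

/-- A connected graph with large chromatic number in which balls are bipartite contains a closed
rope with five joints, far apart from each other, any three of which cut a suitable induced odd
cycle into odd arcs. -/
theorem exists_closed_rope (hG : G.Connected)
    (hball : ∀ v x y, G.dist v x ≤ 100 → G.Adj x y → G.dist v x ≠ G.dist v y)
    {δ : V → V → ℕ} (hδ1 : ∀ x y, δ x y ≤ G.dist x y)
    (hδ2 : ∀ x y z, δ x z ≤ δ x y + G.dist y z)
    (hδ : ∀ c, G.ColOn 2 {x | δ c x ≤ 100}) (hcol : ¬ G.ColOn 46404 Set.univ) :
    ∃ c : ℕ → V, (∀ j j', j < j' → j' ≤ 5 → 86 < δ (c j) (c j')) ∧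
      ∀ a b d, 1 ≤ a → a < b → b < d → d ≤ 5 → ∃ (o : ℕ → V) (N p q r : ℕ),
        G.IsInducedCycle o N ∧ Odd N ∧ p < q ∧ q < r ∧ r < N ∧ Odd (q - p) ∧ Odd (r - q) ∧
        o p = c a ∧ o q = c b ∧ o r = c d := by
  classical
  have tri := fun a b d => hG.dist_triangle (u := a) (v := b) (w := d)
  obtain ⟨z⟩ := hG.nonempty
  obtain ⟨k, hk⟩ := exists_fibre_not_colOn (n := 23202) (X := Set.univ) (f := G.dist z)
    (hG.isLevel_dist z).lip hcol
  obtain ⟨E₀, hE₀, hE₀c, hE₀col, -⟩ := exists_component_not_colOn hk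
  have hlev : ∀ x ∈ E₀, G.dist z x = k := fun x hx => (hE₀ hx).2
  obtain ⟨v₀, hv₀⟩ := nonempty_of_not_colOn hE₀col
  obtain ⟨A₀, hA₀, hA₀c, hA₀col, c₀, hc₀, x₀, hx₀, hcx₀⟩ := exists_component_diff (n := 23200)
    (m := 2) (Y := {x | G.dist v₀ x ≤ 14}) hE₀c hE₀col
    ((hδ v₀).mono (fun x hx => (hδ1 v₀ x).trans ((show G.dist v₀ x ≤ 14 from hx).trans (by omega)))
      le_rfl) hv₀ (by simp)
  have hA₀d : ∀ x ∈ A₀, 14 < G.dist v₀ x := fun x hx => by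
    by_contra h; exact (hA₀ hx).2 (by simpa using h)
  have hA₀k : ∀ x ∈ A₀, G.dist z x = k := fun x hx => hlev x (hA₀ hx).1
  have hv₀c₀ : G.dist v₀ c₀ = 14 := by
    have h1 : G.dist v₀ c₀ ≤ 14 := hc₀.2
    have h2 := hA₀d x₀ hx₀
    have h3 := tri v₀ c₀ x₀
    have h4 := dist_eq_one_iff_adj.2 hcx₀
    omega
  have S₀ : G.RopeState δ A₀ 0 (fun _ => c₀) A₀ {c₀} := by
    refine ⟨hA₀c, subset_rfl, ⟨x₀, hx₀, hcx₀⟩, fun h => ?_, ?_, ?_, ?_, ?_, ?_⟩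
    · have := hA₀d c₀ h; omega
    · intro x _ y hy hne; exact absurd hy hne
    · intro y hy; exact Or.inl hy
    · intro j h1 h2; omega
    · intro j j' h1 h2; omega
    · intro σ
      refine ⟨fun _ => c₀, fun _ => 0, ⟨?_, ?_⟩, ?_, rfl, fun _ _ => rfl, ?_⟩
      · intro i j h1 h2; dsimp only at h2; omega
      · intro i j h1 h2; dsimp only at h2; omega
      · intro k _; rfl
      · intro j hj; omega
  obtain ⟨c₁, E₁, P₁, S₁, h₁, e₁⟩ := S₀.step hG hball hδ1 hδ2 hδ (by omega) (n := 5792) hA₀col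
  obtain ⟨c₂, E₂, P₂, S₂, h₂, e₂⟩ := S₁.step hG hball hδ1 hδ2 hδ (by omega) (n := 1440) h₁
  obtain ⟨c₃, E₃, P₃, S₃, h₃, e₃⟩ := S₂.step hG hball hδ1 hδ2 hδ (by omega) (n := 352) h₂
  obtain ⟨c₄, E₄, P₄, S₄, h₄, e₄⟩ := S₃.step hG hball hδ1 hδ2 hδ (by omega) (n := 80) h₃
  obtain ⟨c, E, P, S, hE, e₅⟩ := S₄.step hG hball hδ1 hδ2 hδ (by omega) (n := 12) h₄
  replace S : G.RopeState δ A₀ 5 c E P := S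
  have hc0 : c 0 = c₀ := by rw [e₅, e₄, e₃, e₂, e₁]
  clear e₁ e₂ e₃ e₄ e₅ S₁ S₂ S₃ S₄ h₁ h₂ h₃ h₄
  have hfar : ∀ j, 1 ≤ j → j ≤ 5 → 86 < G.dist c₀ (c j) := fun j h1 h2 => by
    have := S.far 0 j (by omega) h2
    rw [hc0] at this
    exact this.trans_le (hδ1 _ _)
  -- The 12 colours left after five steps pay for the six balls about the joints; a vertex `y` of
  -- `E` outside them is where the closing path may leave the level.
  obtain ⟨y, hyE, hyfar⟩ := nonempty_of_not_colOn (not_colOn_diff (n := 0) (m := 12)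
    hE (colOn_iUnion_balls hδ c 5))
  have hyfar' : ∀ j ≤ 5, 100 < G.dist (c j) y := fun j hj => by
    refine lt_of_lt_of_le ?_ (hδ1 _ _)
    by_contra h
    exact hyfar ⟨j, hj, by omega⟩
  obtain ⟨s, s0, s1, s2, s3, s4⟩ := hG.exists_geodesic y z
  obtain ⟨t, t0, t1, t2, t3, t4⟩ := hG.exists_geodesic v₀ z
  obtain ⟨g, g0, g1, g2, -, g4⟩ := hG.exists_geodesic v₀ c₀
  have hyz : G.dist y z = k := by rw [dist_comm]; exact hA₀k y (S.subset hyE)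
  have hv₀z : G.dist v₀ z = k := by rw [dist_comm]; exact hlev v₀ hv₀
  rw [hyz] at s1 s2 s3 s4
  rw [hv₀z] at t1 t2 t3 t4
  rw [hv₀c₀] at g1 g2 g4
  let Ly : Set V := {x | ∃ i ≤ k, x = s i}
  let L₀ : Set V := {x | ∃ i ≤ k, x = t i}
  let Gs : Set V := {x | ∃ i ≤ 14, x = g i}
  -- The closing path runs through `E` to `y`, along a shortest path to `z`, back up to `v₀`, and
  -- out to `c 0`. The rope lies in level `k` or near joints of that level, so it could touch a path
  -- to `z` only near its upper end, and `y` and `v₀` are far from it.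
  let Z : Set V := ((insert (c 5) E ∪ Ly) ∪ L₀) ∪ Gs
  have hZconn : G.ConnOn Z := by
    obtain ⟨x, hx, hcx⟩ := S.attached
    refine (((S.conn.insert_of_adj hx hcx).union (connOn_range s4) (Or.inr hyE)
      ⟨0, Nat.zero_le _, s0.symm⟩).union (connOn_range t4) (z := z)
      (Or.inr ⟨k, le_rfl, s1.symm⟩) ⟨k, le_rfl, t1.symm⟩).union (connOn_range g4) (z := v₀)
      (Or.inr ⟨0, Nat.zero_le _, t0.symm⟩) ⟨0, Nat.zero_le _, g0.symm⟩
  obtain ⟨m, ζ, hζ, ζ0, ζm, hζZ⟩ := hZconn.exists_inducedPath (c := c 5) (b := c 0)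
    (Or.inl (Or.inl (Or.inl (Or.inl rfl)))) (Or.inr ⟨14, le_rfl, by rw [hc0, g1]⟩)
  have hm2 : 2 ≤ m := by
    have h5 := hfar 5 (by omega) le_rfl
    rw [← hc0, ← ζ0, ← ζm] at h5
    by_contra hlt
    have : m = 0 ∨ m = 1 := by omega
    rcases this with h | h
    · rw [h] at h5; simp at h5
    · rw [h, dist_comm, dist_eq_one_iff_adj.2 ((hζ.adj_iff 0 1 (by omega) (by omega)).2 rfl)] at h5
      omega
  -- a vertex of a shortest path to `z` is not close to the rope
  have leg : ∀ y' x w, G.dist y' x + G.dist z x ≤ k → G.dist x w ≤ 1 →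
      ((∃ j, 1 ≤ j ∧ j ≤ 5 ∧ G.dist (c j) w ≤ 28) → ∃ j, 1 ≤ j ∧ j ≤ 5 ∧ G.dist y' (c j) ≤ 58) ∧
      (w ∈ A₀ → G.dist y' w ≤ 2) := by
    intro y' x w h1 h2
    have a2 := tri z x w
    have a3 := tri y' x w
    constructor
    · rintro ⟨j, hj1, hj5, hj⟩
      refine ⟨j, hj1, hj5, ?_⟩
      have a1 := hA₀k (c j) (S.mem j hj1 hj5)
      have a4 := tri z w (c j)
      have a5 := tri y' w (c j)
      rw [dist_comm (u := w) (v := c j)] at a4 a5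
      omega
    · intro hw
      have := hA₀k w hw
      omega
  have hcontact : ∀ x ∈ Z, x ≠ c 5 → x ≠ c 0 → ∀ w ∈ P, w ≠ c 5 → w ≠ c 0 →
      w ≠ x ∧ ¬ G.Adj w x := by
    intro x hx hx5 hx0 w hw hw5 hw0
    by_cases hxE : x ∈ E
    · have := S.clean x hxE w hw hw5
      exact ⟨this.1.symm, fun h => this.2 h.symm⟩
    suffices h : 1 < G.dist x w by
      constructor
      · rintro rfl; simp at h
      · intro h'; rw [dist_eq_one_iff_adj.2 h'.symm] at h; omega
    by_contra hle
    rw [not_lt] at hle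
    have hw' := (S.thick w hw).resolve_left hw0
    rcases hx with ((hx | ⟨i, hi, rfl⟩) | ⟨i, hi, rfl⟩) | ⟨i, hi, rfl⟩
    · rcases hx with h | h
      · exact hx5 h
      · exact hxE h
    · have a1 := s2 i hi
      have a2 := s3 i hi
      have hl := leg y (s i) w (by omega) hle
      rcases hw' with h | ⟨h, h'⟩
      · obtain ⟨j, hj1, hj5, hj⟩ := hl.1 h
        have := hyfar' j hj5
        rw [dist_comm] at this
        omega
      · have := hl.2 h
        have := h' y hyE
        omega
    · have a1 := t2 i hi
      have a2 := t3 i hi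
      have hl := leg v₀ (t i) w (by omega) hle
      rcases hw' with h | ⟨h, -⟩
      · obtain ⟨j, hj1, hj5, hj⟩ := hl.1 h
        have b1 := hfar j hj1 hj5
        have b2 := tri c₀ v₀ (c j)
        rw [dist_comm (u := c₀) (v := v₀)] at b2
        omega
      · have := hl.2 h
        have := hA₀d w h
        omega
    · have a1 := g2 i hi
      have hi' : i ≠ 14 := fun h => hx0 (by rw [h, g1, hc0])
      have b0 := tri v₀ (g i) w
      rcases hw' with ⟨j, hj1, hj5, hj⟩ | ⟨h, -⟩
      · have b1 := hfar j hj1 hj5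
        have b2 := tri c₀ v₀ (c j)
        have b3 := tri v₀ w (c j)
        rw [dist_comm (u := c₀) (v := v₀)] at b2
        rw [dist_comm (u := w) (v := c j)] at b3
        omega
      · have := hA₀d w h
        omega
  refine ⟨c, S.far, fun a b d ha hab hbd hd => ?_⟩
  obtain ⟨σ, hσ⟩ := exists_parity_choice m ha hab hbd hd
  obtain ⟨o, p, ho, hoP, p0, hop, hpσ⟩ := S.flex σ
  obtain ⟨q1, q2, q3, q4, q5, q6⟩ := hσ p p0 hpσ
  have hclose := ho.close hζ (by rw [hop 5 le_rfl, ζ0])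
    (by rw [ζm, ← hop 0 (by omega), p0]) (by omega) hm2 (fun i hi hin j hj hjm => by
      have z0 := hop 0 (by omega)
      rw [p0] at z0
      refine hcontact (ζ j) (hζZ j hjm.le) ?_ ?_ (o i) (hoP i hin.le) ?_ ?_
      · rw [← ζ0]; exact (hζ.ne 0 j hj hjm.le).symm
      · rw [← ζm]; exact hζ.ne j m hjm le_rfl
      · rw [← hop 5 le_rfl]; exact ho.ne i _ hin le_rfl
      · rw [← z0]; exact (ho.ne 0 i hi hin.le).symm)
  refine ⟨_, p 5 + m, p a, p b, p d, hclose, q1, q2, q3, by omega, q5, q6, ?_, ?_, ?_⟩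
  · rw [if_pos (by omega)]; exact hop a (by omega)
  · rw [if_pos (by omega)]; exact hop b (by omega)
  · rw [if_pos (by omega)]; exact hop d (by omega)

/-! ### Odd closed walks and balls -/

/-- A repeated vertex splits a closed odd walk into two shorter closed walks, one of which is odd.
-/
theorem exists_odd_cycle {u : V} (w : G.Walk u u) (hw : Odd w.length) :
    ∃ (x : V) (c : G.Walk x x), c.IsCycle ∧ Odd c.length ∧ c.length ≤ w.length := by
  induction h : w.length using Nat.strong_induction_on generalizing u with
  | _ n ih =>
    subst h
    by_cases hp : w.tail.IsPath
    · refine ⟨u, w, Walk.isCycle_iff_isPath_tail_and_le_length.2 ⟨hp, ?_⟩, hw, le_rfl⟩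
      have h1 : w.length ≠ 1 := fun h => (Walk.adj_of_length_eq_one h).ne rfl
      obtain ⟨k, hk⟩ := hw
      omega
    · rw [← Walk.IsPath.getVert_injOn_iff] at hp
      have hlt : w.tail.length + 1 = w.length := Walk.length_tail_add_one (by
        intro h; rw [Walk.length_eq_zero_iff.2 h] at hw; simp at hw)
      have : ∃ i j, i < j ∧ j ≤ w.tail.length ∧ w.tail.getVert i = w.tail.getVert j := by
        simp only [Set.InjOn, Set.mem_ofPred_eq] at hp
        push Not at hp
        obtain ⟨i, hi, j, hj, he, hne⟩ := hp
        rcases lt_or_gt_of_ne hne with h | h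
        · exact ⟨i, j, h, hj, he⟩
        · exact ⟨j, i, h, hi, he.symm⟩
      obtain ⟨i, j, hij, hj, he⟩ := this
      rw [Walk.getVert_tail, Walk.getVert_tail] at he
      let a : G.Walk (w.getVert (i + 1)) (w.getVert (i + 1)) :=
        ((w.drop (i + 1)).take (j - i)).copy rfl (by
          rw [Walk.drop_getVert, he]; congr 1; omega)
      let b : G.Walk u u := (w.take (i + 1)).append ((w.drop (j + 1)).copy he.symm rfl)
      have ha : a.length = j - i := by
        simp only [a, Walk.length_copy, Walk.take_length, Walk.drop_length]; omega
      have hb : b.length = w.length - (j - i) := by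
        simp only [b, Walk.length_append, Walk.length_copy, Walk.take_length, Walk.drop_length]
        omega
      by_cases ho : Odd (j - i)
      · obtain ⟨x, c, h1, h2, h3⟩ := ih _ (by omega) a (ha ▸ ho) rfl
        exact ⟨x, c, h1, h2, by omega⟩
      · have : Odd b.length := by
          rw [hb, Nat.odd_sub (by omega)]
          simpa [hw] using ho
        obtain ⟨x, c, h1, h2, h3⟩ := ih _ (by omega) b this rfl
        exact ⟨x, c, h1, h2, by omega⟩

/-- Equal distances would close two shortest paths and the edge into an odd walk of length at most
201. -/
theorem OddGirthGE.dist_ne (hodd : G.OddGirthGE 203) (hG : G.Connected) {v x y : V}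
    (hx : G.dist v x ≤ 100) (hxy : G.Adj x y) : G.dist v x ≠ G.dist v y := by
  intro h
  obtain ⟨p, hp⟩ := hG.exists_walk_length_eq_dist v x
  obtain ⟨q, hq⟩ := hG.exists_walk_length_eq_dist v y
  have hl : ((p.concat hxy).append q.reverse).length = 2 * G.dist v x + 1 := by
    rw [Walk.length_append, Walk.length_concat, Walk.length_reverse, hp, hq, ← h]; ring
  obtain ⟨z, c, h1, h2, h3⟩ := exists_odd_cycle _ (hl ▸ odd_two_mul_add_one (G.dist v x))
  have := hodd z c h1 h2
  omega

theorem colOn_ball (hodd : G.OddGirthGE 203) (hG : G.Connected) (v : V) :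
    G.ColOn 2 {x | G.dist v x ≤ 100} := by
  refine ⟨fun x => G.dist v x % 2, fun x _ => Nat.mod_lt _ two_pos, fun x hx y _ hxy => ?_⟩
  have h1 := hodd.dist_ne hG hx hxy
  have h2 := hG.dist_triangle (u := v) (v := x) (w := y)
  have h3 := hG.dist_triangle (u := v) (v := y) (w := x)
  rw [dist_eq_one_iff_adj.2 hxy] at h2
  rw [dist_eq_one_iff_adj.2 hxy.symm] at h3
  dsimp only
  omega

/-! ### Minimal connected sets containing given vertices -/

theorem Walk.IsCycle.connOn_support_diff {u : V} {c : G.Walk u u} (hc : c.IsCycle) {x : V}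
    (hx : x ∈ c.support) : G.ConnOn ({y | y ∈ c.support} \ {x}) := by
  classical
  have h' := hc.rotate hx
  have h3 := h'.three_le_length
  set d := c.rotate x hx with hd
  have key := connOn_range (G := G) (τ := fun i => d.getVert (i + 1)) (n := d.length - 2)
    fun i hi => d.adj_getVert_succ (by omega)
  convert key using 1
  ext y
  have hy : y ∈ c.support ↔ y ∈ d.support := by
    rw [hd, Walk.mem_support_rotate_iff]
  rw [Set.mem_sdiff, Set.mem_ofPred_eq, hy, Walk.mem_support_iff_exists_getVert,
    Set.mem_singleton_iff, Set.mem_ofPred_eq]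
  have hinj := h'.getVert_injOn'
  constructor
  · rintro ⟨⟨n, rfl, hn⟩, hne⟩
    have h0 : n ≠ 0 := fun h => hne (by simp [h])
    have hl : n ≠ d.length := fun h => hne (by simp [h])
    exact ⟨n - 1, by omega, by congr 1; omega⟩
  · rintro ⟨i, hi, rfl⟩
    refine ⟨⟨i + 1, rfl, by omega⟩, fun h => ?_⟩
    have := hinj (x₁ := i + 1) (x₂ := 0) (by simp; omega) (by simp) (by simpa using h)
    omega

theorem ReachIn.exists_last {X C : Set V} {x y : V} (h : G.ReachIn X x y) (hx : x ∈ C) :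
    ∃ z ∈ C, G.ReachIn (X \ C) z y := by
  induction h with
  | refl => exact ⟨x, hx, Relation.ReflTransGen.refl⟩
  | @tail b c _ hbc ih =>
    by_cases hc : c ∈ C
    · exact ⟨c, hc, Relation.ReflTransGen.refl⟩
    · obtain ⟨z, hz, h⟩ := ih
      exact ⟨z, hz, h.tail ⟨hbc.1, hbc.2, hc⟩⟩

theorem connOn_setOf_reachIn (X : Set V) (c : V) : G.ConnOn {x | G.ReachIn X c x} := by
  refine connOn_of_reach (c := c) Relation.ReflTransGen.refl fun x hx => ?_
  replace hx : G.ReachIn X c x := hx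
  induction hx with
  | refl => exact Relation.ReflTransGen.refl
  | tail h1 h2 ih => exact ih.tail ⟨h2.1, h1.tail h2⟩

/-- Deleting a vertex of a minimal connected set containing the vertices `g j` separates
some of them from the rest of any cycle through the deleted vertex, so a cycle has at most as many
vertices as there are terminals. -/
theorem exists_bipartite_connOn [Finite V] {n : ℕ} (hodd : G.OddGirthGE (n + 1)) {T : Set V}
    (hT : G.ConnOn T) (g : Fin n → V) (hg : ∀ j, g j ∈ T) :
    ∃ H ⊆ T, G.ConnOn H ∧ (∀ j, g j ∈ H) ∧ G.ColOn 2 H := by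
  classical
  obtain ⟨H, ⟨hHT, hH, hgH⟩, hmin⟩ := (Set.toFinite
    {H : Set V | H ⊆ T ∧ G.ConnOn H ∧ ∀ j, g j ∈ H}).exists_minimal ⟨T, subset_rfl, hT, hg⟩
  refine ⟨H, hHT, hH, hgH, ?_⟩
  by_contra hcol
  have hcol' : ¬ (G.induce H).Colorable 2 := fun h => hcol (colOn_of_colorable_induce h)
  rw [two_colorable_iff_forall_loop_even] at hcol'
  push Not at hcol'
  obtain ⟨u, w, hw⟩ := hcol'
  obtain ⟨x, c₀, hc₀, hc₀', -⟩ := exists_odd_cycle w (Nat.not_even_iff_odd.1 hw)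
  obtain ⟨x, c, hc, hlen, hcH⟩ : ∃ (x : V) (c : G.Walk x x), c.IsCycle ∧ n + 1 ≤ c.length ∧
      ∀ y ∈ c.support, y ∈ H := by
    have hc : (c₀.map (Embedding.induce (G := G) H).toHom).IsCycle :=
      hc₀.map (Embedding.induce (G := G) H).injective
    refine ⟨_, _, hc, hodd _ _ hc (by rw [Walk.length_map]; exact hc₀'), fun y hy => ?_⟩
    rw [Walk.support_map, List.mem_map] at hy
    obtain ⟨z, -, rfl⟩ := hy
    exact z.2
  have h3 := hc.three_le_length
  -- Otherwise the rest of the cycle reaches all terminals without `y`, and what it reaches is a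
  -- smaller connected set containing them.
  have key : ∀ y ∈ c.support, ∃ j, ∀ z ∈ c.support, z ≠ y → ¬ G.ReachIn (H \ {y}) z (g j) := by
    intro y hy
    by_contra hcon
    push Not at hcon
    have hconn := hc.connOn_support_diff hy
    obtain ⟨z₀, hz₀, hz₀y⟩ : ∃ z ∈ c.support, z ≠ y := by
      by_contra hall
      push Not at hall
      have h1 := hall _ (c.getVert_mem_support 0)
      have h2 := hall _ (c.getVert_mem_support 1)
      have := c.adj_getVert_succ (i := 0) (by omega)
      rw [h1, zero_add, h2] at this
      exact this.ne rfl
    have hsub : {x | G.ReachIn (H \ {y}) z₀ x} ⊆ H \ {y} := fun x hx =>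
      ReachIn.mem hx ⟨hcH _ hz₀, hz₀y⟩
    have := hmin (y := {x | G.ReachIn (H \ {y}) z₀ x})
      ⟨(hsub.trans Set.sdiff_subset).trans hHT, connOn_setOf_reachIn _ _, fun j => by
        obtain ⟨z, hz, hzy, hr⟩ := hcon j
        exact ((hconn z₀ ⟨hz₀, hz₀y⟩ z ⟨hz, hzy⟩).mono (Set.sdiff_subset_sdiff_left hcH)).trans hr⟩
      (hsub.trans Set.sdiff_subset)
    exact (hsub (this (hcH _ hy))).2 rfl
  have : Nonempty (Fin n) := ⟨(key _ c.start_mem_support).choose⟩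
  choose! φ hφ using key
  -- On a walk in `H` from `y` to its terminal, the last vertex on the cycle must be `y`; if `y'`
  -- has the same terminal, that vertex must be `y'` as well.
  have hinj : Set.InjOn φ {y | y ∈ c.support} := by
    intro y hy y' hy' he
    obtain ⟨z, hz, hr⟩ := (hH y (hcH y hy) (g (φ y)) (hgH _)).exists_last
      (C := {y | y ∈ c.support}) hy
    have h1 : z = y := by
      by_contra hne
      exact hφ y hy z hz hne (hr.mono (Set.sdiff_subset_sdiff_right (by simpa using hy)))
    have h2 : z = y' := by
      by_contra hne
      refine hφ y' hy' z hz hne ?_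
      rw [← he]
      exact hr.mono (Set.sdiff_subset_sdiff_right (by simpa using hy'))
    rw [← h1, h2]
  have hinj' : Set.InjOn (fun i => φ (c.getVert i)) (Finset.range c.length : Set ℕ) := by
    intro i hi j hj he
    have := hinj (c.getVert_mem_support i) (c.getVert_mem_support j) he
    simp only [Finset.coe_range, Set.mem_Iio] at hi hj
    exact hc.getVert_injOn' (Nat.le_sub_one_of_lt hi) (Nat.le_sub_one_of_lt hj) this
  have := Finset.card_le_card_of_injOn (t := Finset.univ) _ (fun _ _ => Finset.mem_univ _) hinj'
  simp at this
  omega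

/-! ### The hub -/

theorem ConnOn.preconnected {X : Set V} (hX : G.ConnOn X) : (G.induce X).Preconnected := by
  rintro ⟨x, hx⟩ ⟨y, hy⟩
  have h := hX x hx y hy
  induction h with
  | refl => exact Reachable.refl _
  | @tail b c hb hbc ih =>
    have hbX := ReachIn.mem hb hx
    exact (ih hbX).trans (Adj.reachable (G := G.induce X) (u := ⟨b, hbX⟩) (v := ⟨c, hy⟩) hbc.1)

theorem exists_three_eq (f : Fin 5 → ℕ) (hf : ∀ j, f j < 2) :
    ∃ a b d, a < b ∧ b < d ∧ f b = f a ∧ f d = f a := by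
  by_contra hcon
  push Not at hcon
  have h0 := hf 0
  have h1 := hf 1
  have h2 := hf 2
  have h3 := hf 3
  have h4 := hf 4
  have h012 := hcon 0 1 2 (by decide) (by decide)
  have h013 := hcon 0 1 3 (by decide) (by decide)
  have h014 := hcon 0 1 4 (by decide) (by decide)
  have h023 := hcon 0 2 3 (by decide) (by decide)
  have h024 := hcon 0 2 4 (by decide) (by decide)
  have h034 := hcon 0 3 4 (by decide) (by decide)
  have h123 := hcon 1 2 3 (by decide) (by decide)
  have h124 := hcon 1 2 4 (by decide) (by decide)
  have h134 := hcon 1 3 4 (by decide) (by decide)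
  have h234 := hcon 2 3 4 (by decide) (by decide)
  omega

/-- Five far apart vertices of one distance level cannot be such that any three of them lie, at odd
distances in order, on an induced odd cycle within that level: below the level they can be joined
by a bipartite connected graph. -/
theorem false_of_odd_cycles_in_level [Finite V] (ht : G.tStab ⊆ G.stableSetPolytope)
    (hodd : G.OddGirthGE 203) (hG : G.Connected) {z : V} {s : ℕ} {c : Fin 5 → V}
    (hc : ∀ j, G.dist z (c j) = s) (hfar : ∀ j j', j < j' → 4 < G.dist (c j) (c j'))
    (hcyc : ∀ a b d, a < b → b < d → ∃ (o : ℕ → V) (N p q r : ℕ), G.IsInducedCycle o N ∧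
      (∀ k < N, G.dist z (o k) = s) ∧ Odd N ∧ p < q ∧ q < r ∧ r < N ∧ Odd (q - p) ∧ Odd (r - q) ∧
      o p = c a ∧ o q = c b ∧ o r = c d) : False := by
  classical
  have hfar' : ∀ j j', G.dist (c j) (c j') ≤ 4 → j = j' := by
    intro j j' h
    rcases lt_trichotomy j j' with h1 | h1 | h1
    · have := hfar _ _ h1; omega
    · exact h1
    · have := hfar _ _ h1; rw [dist_comm] at this; omega
  have hstep : ∀ x y, G.Adj x y → ∀ v, G.dist v y ≤ G.dist v x + 1 := by
    intro x y h v
    have := hG.dist_triangle (u := v) (v := x) (w := y)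
    rwa [dist_eq_one_iff_adj.2 h] at this
  have hs : 2 ≤ s := by
    have h1 := hfar 0 1 (by decide)
    have h2 := hG.dist_triangle (u := c 0) (v := z) (w := c 1)
    rw [dist_comm (u := c 0) (v := z), hc, hc] at h2
    omega
  choose τ τ0 τ1 τ2 τ3 τ4 using fun j => hG.exists_geodesic z (c j)
  simp only [hc] at τ1 τ2 τ3 τ4
  -- Stopping at level `s - 2` keeps this set nonadjacent to level `s`; only the vertices `τ j (s -
  -- 1)` will attach the hub to the cycle.
  let T : Set V := {x | ∃ j, ∃ k ≤ s - 2, x = τ j k}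
  have hzT : z ∈ T := ⟨0, 0, by omega, (τ0 0).symm⟩
  have hT : G.ConnOn T := by
    refine connOn_of_reach hzT ?_
    rintro x ⟨j, k, hk, rfl⟩
    have := connOn_range (G := G) (τ := τ j) (n := s - 2) fun i hi => τ4 j i (by omega)
    have hsub : {x | ∃ i ≤ s - 2, x = τ j i} ⊆ T := fun x ⟨i, hi, hx⟩ => ⟨j, i, hi, hx⟩
    exact ReachIn.mono hsub
      (this z ⟨0, by omega, (τ0 j).symm⟩ (τ j k) ⟨k, hk, rfl⟩)
  obtain ⟨H, hHT, hH, hgH, f, hf1, hf2⟩ := exists_bipartite_connOn (n := 5)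
    (fun u w hw hw' => (by omega : 5 + 1 ≤ 203).trans (hodd u w hw hw')) hT
    (fun j => τ j (s - 2)) fun j => ⟨j, s - 2, le_rfl, rfl⟩
  have hHs : ∀ x ∈ H, G.dist z x ≤ s - 2 := by
    intro x hx
    obtain ⟨j, k, hk, rfl⟩ := hHT hx
    rw [τ2 j k (by omega)]; exact hk
  have hps : ∀ j, G.dist z (τ j (s - 1)) = s - 1 := fun j => τ2 j _ (by omega)
  have hpc : ∀ j, G.dist (c j) (τ j (s - 1)) ≤ 1 := fun j =>
    (τ3 j (s - 1) (by omega)).trans (by omega)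
  have hpg : ∀ j, G.Adj (τ j (s - 2)) (τ j (s - 1)) := by
    intro j
    have := τ4 j (s - 2) (by omega)
    rwa [show s - 2 + 1 = s - 1 by omega] at this
  -- A neighbour on the path of another joint would put the two joints at distance at most 4.
  have hpH : ∀ j, ∀ x ∈ H, G.Adj (τ j (s - 1)) x → x = τ j (s - 2) := by
    intro j x hx hadj
    have h1 := hHs x hx
    have h2 := hstep _ _ hadj.symm z
    rw [hps] at h2
    have h3 := hstep _ _ hadj (c j)
    obtain ⟨j', k, hk, rfl⟩ := hHT hx
    rw [τ2 j' k (by omega)] at h1 h2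
    have hk' : k = s - 2 := by omega
    subst hk'
    have h4 := τ3 j' (s - 2) (by omega)
    have h5 := hG.dist_triangle (u := c j) (v := τ j' (s - 2)) (w := c j')
    rw [dist_comm (u := τ j' (s - 2)) (v := c j')] at h5
    have h6 := hpc j
    rw [hfar' j j' (by omega)]
  have hpp : ∀ j j', ¬ G.Adj (τ j (s - 1)) (τ j' (s - 1)) := by
    intro j j' hadj
    have h1 := hpc j
    have h2 := hpc j'
    have h3 := hstep _ _ hadj (c j)
    have h5 := hG.dist_triangle (u := c j) (v := τ j' (s - 1)) (w := c j')
    rw [dist_comm (u := τ j' (s - 1)) (v := c j')] at h5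
    rw [hfar' j j' (by omega)] at hadj
    exact hadj.ne rfl
  obtain ⟨a, b, d, hab, hbd, hfb, hfd⟩ := exists_three_eq (fun j => f (τ j (s - 2)))
    fun j => hf1 _ (hgH j)
  obtain ⟨o, N, p, q, r, ho, hoK, hN, hpq, hqr, hrN, h1, h2, hoa, hob, hod⟩ := hcyc a b d hab hbd
  let P : Set V := {x | ∃ j, (j = a ∨ j = b ∨ j = d) ∧ x = τ j (s - 1)}
  have hPadj : ∀ x ∈ P, ∀ y ∈ H, G.Adj x y → f y = f (τ a (s - 2)) := by
    rintro x ⟨j, hj, rfl⟩ y hy hadj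
    rw [hpH j y hy hadj]
    rcases hj with rfl | rfl | rfl
    · rfl
    · exact hfb
    · exact hfd
  -- `A` is the side of `H` holding the feet of the three chosen connectors, so the connectors
  -- themselves join the opposite side `B`.
  let A : Set V := {x ∈ H | f x = f (τ a (s - 2))}
  let B : Set V := {x ∈ H | f x ≠ f (τ a (s - 2))} ∪ P
  have hAB : A ∪ B =
      insert (τ a (s - 1)) (insert (τ b (s - 1)) (insert (τ d (s - 1)) H)) := by
    ext x
    simp only [A, B, P, Set.mem_union, Set.mem_ofPred_eq, Set.mem_insert_iff]
    constructor
    · rintro (h | h | ⟨j, rfl | rfl | rfl, rfl⟩)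
      · simp [h.1]
      · simp [h.1]
      all_goals simp
    · rintro (h | h | h | h)
      · exact Or.inr (Or.inr ⟨a, by simp, h⟩)
      · exact Or.inr (Or.inr ⟨b, by simp, h⟩)
      · exact Or.inr (Or.inr ⟨d, by simp, h⟩)
      · by_cases hfx : f x = f (τ a (s - 2))
        · exact Or.inl ⟨h, hfx⟩
        · exact Or.inr (Or.inl ⟨h, hfx⟩)
  have hconn : G.ConnOn (A ∪ B) := by
    rw [hAB]
    refine ConnOn.insert_of_adj (ConnOn.insert_of_adj (ConnOn.insert_of_adj hH (hgH d) ?_)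
      (Or.inr (hgH b)) ?_) (Or.inr (Or.inr (hgH a))) ?_
    · exact (hpg d).symm
    · exact (hpg b).symm
    · exact (hpg a).symm
  have hBs : ∀ x ∈ B, G.dist z x ≤ s - 1 := by
    rintro x (h | ⟨j, -, rfl⟩)
    · have := hHs x h.1; omega
    · rw [hps]
  have hpo : ∀ (j : Fin 5) (k : ℕ), (j = a ∨ j = b ∨ j = d) → o k = c j →
      ∃ x ∈ B, G.Adj x (o k) := by
    intro j k hj hk
    refine ⟨τ j (s - 1), Or.inr ⟨j, hj, rfl⟩, ?_⟩
    have := τ4 j (s - 1) (by omega)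
    rwa [show s - 1 + 1 = s by omega, τ1, ← hk] at this
  refine false_of_hub ht hN ho hpq hqr hrN h1 h2 (A := A) (B := B) ?_ ?_ ?_ hconn.preconnected
    ?_ ?_ ?_ (hpo a p (by simp) hoa) (hpo b q (by simp) hob) (hpo d r (by simp) hod)
  · intro x hx y hy _ hadj
    exact hf2 x hx.1 y hy.1 hadj (hx.2.trans hy.2.symm)
  · rintro x (hx | hx) y (hy | hy) _ hadj
    · have h3 := hf1 x hx.1
      have h4 := hf1 y hy.1
      have h5 := hf1 _ (hgH a)
      have h6 := hf2 x hx.1 y hy.1 hadj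
      have h7 := hx.2
      have h8 := hy.2
      omega
    · exact hx.2 (hPadj y hy x hx.1 hadj.symm)
    · exact hy.2 (hPadj x hx y hy.1 hadj)
    · obtain ⟨j, -, rfl⟩ := hx
      obtain ⟨j', -, rfl⟩ := hy
      exact hpp j j' hadj
  · rw [Set.disjoint_left]
    rintro x hx (h | ⟨j, -, rfl⟩)
    · exact h.2 hx.2
    · have := hHs _ hx.1
      rw [hps] at this
      omega
  · intro k hk h
    have := hHs _ h.1
    rw [hoK k hk] at this
    omega
  · intro k hk h
    have := hBs _ h
    rw [hoK k hk] at this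
    omega
  · intro k hk x hx hadj
    have h3 := hHs x hx.1
    have h4 := hstep _ _ hadj z
    rw [hoK k hk] at h4
    omega

/-! ### The bound -/

theorem colOn_of_connected [Finite V] (ht : G.tStab ⊆ G.stableSetPolytope)
    (hodd : G.OddGirthGE 203) (hG : G.Connected) : G.ColOn (2 * 46404) Set.univ := by
  by_contra hcol
  obtain ⟨z⟩ := hG.nonempty
  obtain ⟨s, hs⟩ := exists_fibre_not_colOn (f := G.dist z) (fun x _ y _ hxy => by
    have := hG.dist_triangle (u := z) (v := y) (w := x)
    rwa [dist_eq_one_iff_adj.2 hxy.symm] at this) hcol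
  obtain ⟨K, hKs, hK, hKcol, -⟩ := exists_component_not_colOn hs
  obtain ⟨k₀, hk₀⟩ := nonempty_of_not_colOn hKcol
  have hne : Nonempty K := ⟨⟨k₀, hk₀⟩⟩
  have hKG : (G.induce K).Connected := ⟨hK.preconnected⟩
  have hle : ∀ x y : K, G.dist x y ≤ (G.induce K).dist x y := by
    intro x y
    obtain ⟨p, hp⟩ := hKG.exists_walk_length_eq_dist x y
    have := dist_le (p.map (Embedding.induce (G := G) K).toHom)
    rwa [Walk.length_map, hp] at this
  have hodd' := hodd.induce K
  -- The rope is built with distances of `G.induce K`, but its joints must be far apart in `G`,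
  -- where the hub lives; this is the role of `δ`.
  obtain ⟨c, hc, hcyc⟩ := exists_closed_rope hKG (fun v x y hx hxy => hodd'.dist_ne hKG hx hxy)
    (δ := fun x y => G.dist x y) hle
    (fun x y w => hG.dist_triangle.trans (Nat.add_le_add_left (hle y w) _))
    (fun v => by
      obtain ⟨f, h1, h2⟩ := colOn_ball hodd hG v
      exact ⟨fun x => f x, fun x hx => h1 x hx, fun x hx y hy hxy => h2 x hx y hy hxy⟩)
    (fun h => hKcol (colOn_of_colorable_induce h.colorable))
  refine false_of_odd_cycles_in_level ht hodd hG (z := z) (s := s)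
    (c := fun j => c ((j : ℕ) + 1)) (fun j => (hKs (c _).2).2) (fun j j' hjj' => ?_)
    fun a b d hab hbd => ?_
  · have := hc (j + 1) (j' + 1) (by have := hjj'; omega) (by omega)
    omega
  · obtain ⟨o, N, p, q, r, ho, hN, hpq, hqr, hrN, h1, h2, h3, h4, h5⟩ :=
      hcyc (a + 1) (b + 1) (d + 1) (by omega) (by omega) (by omega) (by omega)
    refine ⟨fun i => o i, N, p, q, r, ⟨fun i j hij hj h => ho.ne i j hij hj (Subtype.ext h),
      fun i j hij hj => ho.adj_iff i j hij hj⟩, fun k _ => (hKs (o k).2).2, hN, hpq, hqr, hrN, h1,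
      h2, congrArg _ h3, congrArg _ h4, congrArg _ h5⟩

theorem colOn_of_oddGirthGE [Finite V] (ht : G.tStab ⊆ G.stableSetPolytope)
    (hodd : G.OddGirthGE 203) : G.ColOn (2 * 46404) Set.univ := by
  by_contra hcol
  obtain ⟨K, -, hK, hKcol, -⟩ := exists_component_not_colOn hcol
  obtain ⟨k₀, hk₀⟩ := nonempty_of_not_colOn hKcol
  have hne : Nonempty K := ⟨⟨k₀, hk₀⟩⟩
  exact hKcol (colOn_of_colorable_induce (colOn_of_connected (tStab_subset_induce ht K)
    (hodd.induce K) ⟨hK.preconnected⟩).colorable)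

/-- Each of the `m` deletions costs one colour and raises `k` by one; `k = 101` is odd girth 203. -/
theorem colOn_of_tStab_subset [Finite V] (ht : G.tStab ⊆ G.stableSetPolytope) {k m : ℕ}
    (hk : 1 ≤ k) (hkm : k + m = 101) (hodd : G.OddGirthGE (2 * k + 1)) :
    G.ColOn (2 * 46404 + m) Set.univ := by
  induction m generalizing V k with
  | zero =>
    obtain rfl : k = 101 := by omega
    exact colOn_of_oddGirthGE ht hodd
  | succ m ih =>
    obtain ⟨S, hS, hodd'⟩ := exists_stable_raising_oddGirth ht hk hodd
    have h1 := colOn_of_colorable_induce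
      (ih (tStab_subset_induce ht Sᶜ) (k := k + 1) (by omega) (by omega) hodd').colorable
    have h2 : G.ColOn 1 S := ⟨fun _ => 0, fun _ _ => one_pos,
      fun x hx y hy hxy => absurd hxy (hS hx hy hxy.ne)⟩
    exact (h1.union h2).mono (by simp) (by omega)

end SimpleGraph

theorem theorem1p1 {V : Type*} [Finite V] (G : SimpleGraph V) (hG : G.IsTPerfect) :
    G.Colorable 199053 := by
  -- Cycles have length at least 3, so the deletions start at `k = 1`; the count reached is 92908.
  exact (SimpleGraph.colOn_of_tStab_subset hG.ge (k := 1) (m := 100) le_rfl rfl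
    fun _ _ hc _ => hc.three_le_length).colorable.mono (by norm_num)
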